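/- Let $T>0$, let $(M,g)$ be a smooth $n$-dimensional Riemannian manifold without boundary, and let $L:(\mathbb R/T\mathbb Z)\times TM\to\mathbb R$ be a smooth Lagrangian which is non-degenerate on the fibres (every fibre Hessian $\nabla_{vv}L(t,q,v)$ is a non-degenerate quadratic form) and is a polynomial of degree at most $2$ in the velocity $v$. Let $x:\mathbb R\to M$ be a $T$-periodic $C^2$ solution of the Euler--Lagrange equation of $L$. Let $e_1(t),\dots,e_n(t)$ be a parallel orthonormal frame along $x$, let $E_t:\mathbb R^n\to T_{x(t)}M$ send the standard basis to $e_1(t),\dots,e_n(t)$, and put $A=E_0^{-1}E_T\in O(n)$ and $A_d=\begin{pmatrix}A&0\\0&A\end{pmatrix}$. Let $$P=(\nabla_{vv}L)_{ij},\qquad Q=(\nabla_{qv}L)_{ij},\qquad R=(\nabla_{qq}L)_{ij}$$ be the matrices, in this frame, of the second variation of the action along $x$: for a vector field $\xi(t)=E_tu(t)$ along $x$, $$d^2\mathbb E(x)[\xi,\xi]=\int_0^T\big(\langle Pu',u'\rangle+2\langle Qu,u'\rangle+\langle Ru,u\rangle\big)\,dt,$$ where the integrand is the second derivative at $s=0$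 of $L\big(t,c_s(t),c_s'(t)\big)$ with $c_s(t)=\exp_{x(t)}(s\,E_tu(t))$. Let $J=\begin{pmatrix}0&-I\\I&0\end{pmatrix}$, let $\omega(z_1,z_2)=\langle Jz_1,z_2\rangle$ on $\mathbb R^{2n}$, and let $\psi:[0,T]\to \mathrm{Sp}(2n,\mathbb R)$ be the fundamental solution ($\psi(0)=I$) of $$z'=JB(t)z,\qquad B=\begin{pmatrix}P^{-1}&-P^{-1}Q\\-Q^{\mathsf T}P^{-1}&Q^{\mathsf T}P^{-1}Q-R\end{pmatrix},\qquad z=(Pu'+Qu,\,u).$$ The geometrical index of $x$ is $$\iota_{\mathrm{geo}}(x)=\iota_{\mathrm{CLM}}\big(\Delta,\mathrm{Gr}(A_d\psi(t)),\,t\in[0,T]\big)=\big[e^{-\varepsilon\mathcal J}\,\mathrm{Gr}(A_d\psi(t)):\Sigma(\Delta)\big],\qquad 0<\varepsilon\ll1,$$ in the symplectic space $(\mathbb R^{2n}\times\mathbb R^{2n},-\omega\times\omega)$, where $\mathcal J=\mathrm{diag}(-J,J)$, $\Delta$ is the diagonal, $\mathrm{Gr}(S)=\{(z,Sz)\}$,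 and $[\,\cdot:\Sigma(\Delta)]$ is the intersection number of a path of Lagrangian subspaces, with end points off $\Sigma(\Delta)$, with the Maslov cycle $\Sigma(\Delta)=\{\ell:\ell\cap\Delta\neq0\}$, co-oriented by the direction of $s\mapsto e^{s\mathcal J}\ell$. Call $x$ linearly stable if its linearized Poincaré map, which is $A_d\psi(T)$ in the frame, has its spectrum on the unit circle and is semisimple, and linearly unstable otherwise. If $\iota_{\mathrm{geo}}(x)$ is odd, then $x$ is linearly unstable. -/

import Mathlib

open scoped Manifold ContDiff Topology

noncomputable section

namespace Lagrangian

/-! ### Intersection number with the Maslov cycle and the CLM index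

The symplectic vector space is `EuclideanSpace ℝ ι` with the form `ω(u, v) = ⟪J u, v⟫`, where `J` is
an orthogonal matrix with `J² = -1`. -/

section Maslov

variable {ι : Type} [Fintype ι] [DecidableEq ι]

/-- The symplectic form `ω(u, v) = ⟪J u, v⟫`. -/
def symplForm (J : Matrix ι ι ℝ) (u v : EuclideanSpace ℝ ι) : ℝ :=
  inner ℝ (Matrix.toEuclideanLin J u) v

/-- A subspace is Lagrangian if it equals its symplectic orthogonal. -/
def IsLagrangianSubspace (J : Matrix ι ι ℝ) (W : Submodule ℝ (EuclideanSpace ℝ ι)) : Prop :=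
  ∀ v, v ∈ W ↔ ∀ u ∈ W, symplForm J u v = 0

/-- The crossing form `v ↦ ω(v, c'(t))` of a path `m` of subspaces, where `c` is a curve in `m` with
`c(t) = v`; here `c(s)` is the orthogonal projection of `v` onto `m s`. On `m t` the value does not
depend on the choice of the curve `c`. -/
def crossingForm (J : Matrix ι ι ℝ) (m : ℝ → Submodule ℝ (EuclideanSpace ℝ ι)) (a b t : ℝ)
    (v : EuclideanSpace ℝ ι) : ℝ :=
  symplForm J v (derivWithin (fun s => (m s).starProjection v) (Set.Icc a b) t)

/-- A `C¹` path of Lagrangian subspaces, parametrised by `[a, b]`, which meets the Maslov cycle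
`Σ(W) = {ℓ | ℓ ∩ W ≠ 0}` finitely many times, only in its top stratum `dim (ℓ ∩ W) = 1`,
and transversally. -/
structure IsTransversePath (J : Matrix ι ι ℝ) (W : Submodule ℝ (EuclideanSpace ℝ ι))
    (m : ℝ → Submodule ℝ (EuclideanSpace ℝ ι)) (a b : ℝ) : Prop where
  lagrangian : ∀ t ∈ Set.Icc a b, IsLagrangianSubspace J (m t)
  contDiffOn : ContDiffOn ℝ 1 (fun t => (m t).starProjection) (Set.Icc a b)
  finite : {t ∈ Set.Icc a b | m t ⊓ W ≠ ⊥}.Finite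
  simple : ∀ t ∈ Set.Icc a b, Module.finrank ℝ ↥(m t ⊓ W) ≤ 1
  transverse : ∀ t ∈ Set.Icc a b, ∀ v ∈ m t ⊓ W, v ≠ 0 → crossingForm J m a b t v ≠ 0

/-- The number of crossings in the positive direction (that of `s ↦ e^{sJ} ℓ`) minus the number of
crossings in the negative direction. -/
def signedCrossings (J : Matrix ι ι ℝ) (W : Submodule ℝ (EuclideanSpace ℝ ι))
    (m : ℝ → Submodule ℝ (EuclideanSpace ℝ ι)) (a b : ℝ) : ℤ :=
  ({t ∈ Set.Icc a b | ∃ v ∈ m t ⊓ W, 0 < crossingForm J m a b t v}.ncard : ℤ) -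
    ({t ∈ Set.Icc a b | ∃ v ∈ m t ⊓ W, crossingForm J m a b t v < 0}.ncard : ℤ)

/-- `k` is the intersection number `[ℓ : Σ(W)]` of a continuous Lagrangian path `ℓ` on `[a, b]`, with
end points off `Σ(W)`, with the co-oriented Maslov cycle `Σ(W)`: the signed number of crossings of
transverse paths that have the same end points as `ℓ` and are arbitrarily close to `ℓ` (in the gap
metric, that is, the distance of the orthogonal projections). -/
def IsIntersectionNumber (J : Matrix ι ι ℝ) (W : Submodule ℝ (EuclideanSpace ℝ ι))
    (ℓ : ℝ → Submodule ℝ (EuclideanSpace ℝ ι)) (a b : ℝ) (k : ℤ) : Prop :=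
  ℓ a ⊓ W = ⊥ ∧ ℓ b ⊓ W = ⊥ ∧
    ∀ δ > 0, ∃ m : ℝ → Submodule ℝ (EuclideanSpace ℝ ι),
      m a = ℓ a ∧ m b = ℓ b ∧
      (∀ t ∈ Set.Icc a b, ‖(m t).starProjection - (ℓ t).starProjection‖ < δ) ∧
      IsTransversePath J W m a b ∧ signedCrossings J W m a b = k

/-- `k = ι_CLM(W, ℓ(t), t ∈ [a, b]) = [e^{-εJ} ℓ(t) : Σ(W)]` for all sufficiently small `ε > 0`. -/
def IsCLMIndex (J : Matrix ι ι ℝ) (W : Submodule ℝ (EuclideanSpace ℝ ι))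
    (ℓ : ℝ → Submodule ℝ (EuclideanSpace ℝ ι)) (a b : ℝ) (k : ℤ) : Prop :=
  ∀ᶠ ε in 𝓝[>] (0 : ℝ),
    IsIntersectionNumber J W
      (fun t => (ℓ t).map (Matrix.toEuclideanLin (NormedSpace.exp (-(ε • J))))) a b k

/-- The graph `{(z, S z)}` of a matrix. -/
def graph (S : Matrix ι ι ℝ) : Submodule ℝ (EuclideanSpace ℝ (ι ⊕ ι)) :=
  LinearMap.range (Matrix.toEuclideanLin (Matrix.fromRows 1 S))

/-- The complex structure of the symplectic form `-ω × ω` on the product. -/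
def prodJ (J : Matrix ι ι ℝ) : Matrix (ι ⊕ ι) (ι ⊕ ι) ℝ :=
  Matrix.fromBlocks (-J) 0 0 J

/-- Linear stability of a real matrix: the spectrum lies on the unit circle and the matrix is
semisimple, that is, diagonalizable over `ℂ`. -/
def IsLinearlyStable (S : Matrix ι ι ℝ) : Prop :=
  spectrum ℂ (S.map Complex.ofReal) ⊆ Metric.sphere 0 1 ∧
    ∃ (C : Matrix ι ι ℂ) (d : ι → ℂ), IsUnit C ∧
      S.map Complex.ofReal = C * Matrix.diagonal d * C⁻¹

end Maslov

/-! ### Lagrangian systems on a Riemannian manifold -/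

section Manifold

variable {n : ℕ} {M : Type*} [TopologicalSpace M] [ChartedSpace (EuclideanSpace ℝ (Fin n)) M]
  [IsManifold (𝓡 n) ∞ M]

/-- The differential at `y` of the inverse of the preferred chart at `p`. -/
def chartBasis (p : M) (y : EuclideanSpace ℝ (Fin n)) :
    EuclideanSpace ℝ (Fin n) →L[ℝ] TangentSpace (𝓡 n) ((extChartAt (𝓡 n) p).symm y) :=
  mfderiv 𝓘(ℝ, EuclideanSpace ℝ (Fin n)) (𝓡 n) (extChartAt (𝓡 n) p).symm y

/-- The coefficients `g_{ij}(y)` of the metric in the chart at `p`. -/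
def metricCoeff
    (g : Bundle.ContMDiffRiemannianMetric (𝓡 n) ∞ (EuclideanSpace ℝ (Fin n))
      (fun q : M => TangentSpace (𝓡 n) q))
    (p : M) (y : EuclideanSpace ℝ (Fin n)) : Matrix (Fin n) (Fin n) ℝ :=
  Matrix.of fun i j => g.inner ((extChartAt (𝓡 n) p).symm y)
    (chartBasis p y (EuclideanSpace.single i 1)) (chartBasis p y (EuclideanSpace.single j 1))

/-- The partial derivative `∂_k g_{ij}(y)`. -/
def metricCoeffDeriv
    (g : Bundle.ContMDiffRiemannianMetric (𝓡 n) ∞ (EuclideanSpace ℝ (Fin n))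
      (fun q : M => TangentSpace (𝓡 n) q))
    (p : M) (y : EuclideanSpace ℝ (Fin n)) (k i j : Fin n) : ℝ :=
  fderiv ℝ (fun y' => metricCoeff g p y' i j) y (EuclideanSpace.single k 1)

/-- The Christoffel symbols `Γ^k_{ij}` of the Levi-Civita connection in the chart at `p`, as the
bilinear map `(a, b) ↦ ∑ Γ^k_{ij} a_i b_j`. -/
def christoffel
    (g : Bundle.ContMDiffRiemannianMetric (𝓡 n) ∞ (EuclideanSpace ℝ (Fin n))
      (fun q : M => TangentSpace (𝓡 n) q))
    (p : M) (y a b : EuclideanSpace ℝ (Fin n)) : EuclideanSpace ℝ (Fin n) :=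
  WithLp.toLp 2 fun k => ∑ i, ∑ j, ∑ l,
    (1 / 2 : ℝ) * (metricCoeff g p y)⁻¹ k l *
      (metricCoeffDeriv g p y i j l + metricCoeffDeriv g p y j i l - metricCoeffDeriv g p y l i j) *
      a i * b j

/-- The Lagrangian in the coordinates `(y, w)` of `TM` induced by the chart at `p`. -/
def coordLagrangian (L : ℝ → TangentBundle (𝓡 n) M → ℝ) (p : M) (t : ℝ)
    (y w : EuclideanSpace ℝ (Fin n)) : ℝ :=
  L t ⟨(extChartAt (𝓡 n) p).symm y, chartBasis p y w⟩

/-- The fibre Hessians `∇_{vv} L (t, q, v)` are non-degenerate. -/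
def FibreNondegenerate (L : ℝ → TangentBundle (𝓡 n) M → ℝ) : Prop :=
  ∀ (t : ℝ) (q : M) (v a : EuclideanSpace ℝ (Fin n)),
    (∀ b : EuclideanSpace ℝ (Fin n),
      iteratedFDeriv ℝ 2 (fun w : EuclideanSpace ℝ (Fin n) => L t ⟨q, w⟩) v ![a, b] = 0) → a = 0

/-- `L` is a polynomial of degree at most two in the velocity. -/
def FibreQuadratic (L : ℝ → TangentBundle (𝓡 n) M → ℝ) : Prop :=
  ∀ (t : ℝ) (q : M), ∃ (β : LinearMap.BilinForm ℝ (TangentSpace (𝓡 n) q))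
    (α : Module.Dual ℝ (TangentSpace (𝓡 n) q)) (c : ℝ),
      ∀ v : TangentSpace (𝓡 n) q, L t ⟨q, v⟩ = β v v + α v + c

/-- The curve `x` in the chart at `p`. -/
def coordCurve (x : ℝ → M) (p : M) (t : ℝ) : EuclideanSpace ℝ (Fin n) :=
  extChartAt (𝓡 n) p (x t)

/-- `x` is a `T`-periodic solution, of class `C²`, of the Euler-Lagrange equation. The equation
`d/dt ∂_w L = ∂_y L` is written at each time `t` in the chart at `x t`. -/
structure IsPeriodicOrbit (T : ℝ) (L : ℝ → TangentBundle (𝓡 n) M → ℝ) (x : ℝ → M) : Prop where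
  contMDiff : ContMDiff 𝓘(ℝ, ℝ) (𝓡 n) 2 x
  periodic : ∀ t, x (t + T) = x t
  eulerLagrange : ∀ t,
    HasDerivAt
      (fun s => fderiv ℝ (coordLagrangian L (x t) s (coordCurve x (x t) s))
        (deriv (coordCurve x (x t)) s))
      (fderiv ℝ (fun y => coordLagrangian L (x t) t y (deriv (coordCurve x (x t)) t))
        (coordCurve x (x t) t)) t

/-- The vector `e t` of a vector field along `x`, in the chart at `p`. -/
def coordField (x : ℝ → M) (e : (t : ℝ) → TangentSpace (𝓡 n) (x t)) (p : M) (t : ℝ) :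
    EuclideanSpace ℝ (Fin n) :=
  mfderiv (𝓡 n) 𝓘(ℝ, EuclideanSpace ℝ (Fin n)) (extChartAt (𝓡 n) p) (x t) (e t)

/-- `e₁, …, e_n` is an orthonormal frame along `x`, parallel for the Levi-Civita connection:
`∇_t e_i = 0`, written at each time `t` in the chart at `x t`. -/
structure IsParallelOrthonormalFrame
    (g : Bundle.ContMDiffRiemannianMetric (𝓡 n) ∞ (EuclideanSpace ℝ (Fin n))
      (fun q : M => TangentSpace (𝓡 n) q))
    (x : ℝ → M) (e : Fin n → (t : ℝ) → TangentSpace (𝓡 n) (x t)) : Prop where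
  orthonormal : ∀ t i j, g.inner (x t) (e i t) (e j t) = if i = j then 1 else 0
  parallel : ∀ t i,
    HasDerivAt (coordField x (e i) (x t))
      (-christoffel g (x t) (coordCurve x (x t) t) (deriv (coordCurve x (x t)) t)
        (coordField x (e i) (x t) t)) t

/-- The orthogonal matrix `A = E₀⁻¹ E_T`, where `E_t` sends the standard basis to the frame at
time `t`, for a curve with `x T = x 0`. -/
def holonomyMatrix
    (g : Bundle.ContMDiffRiemannianMetric (𝓡 n) ∞ (EuclideanSpace ℝ (Fin n))
      (fun q : M => TangentSpace (𝓡 n) q))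
    (T : ℝ) (x : ℝ → M) (e : Fin n → (t : ℝ) → TangentSpace (𝓡 n) (x t)) :
    Matrix (Fin n) (Fin n) ℝ :=
  Matrix.of fun i j => g.inner (x 0) (e i 0) (show TangentSpace (𝓡 n) (x 0) from e j T)

/-- The matrix `A_d = diag(A, A)`. -/
def holonomyDouble
    (g : Bundle.ContMDiffRiemannianMetric (𝓡 n) ∞ (EuclideanSpace ℝ (Fin n))
      (fun q : M => TangentSpace (𝓡 n) q))
    (T : ℝ) (x : ℝ → M) (e : Fin n → (t : ℝ) → TangentSpace (𝓡 n) (x t)) :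
    Matrix (Fin n ⊕ Fin n) (Fin n ⊕ Fin n) ℝ :=
  Matrix.fromBlocks (holonomyMatrix g T x e) 0 0 (holonomyMatrix g T x e)

/-- In the chart at `p`, the vector `E_t u = ∑ u_i e_i(t)`. -/
def coordFrame (x : ℝ → M) (e : Fin n → (t : ℝ) → TangentSpace (𝓡 n) (x t)) (p : M) (t : ℝ)
    (u : EuclideanSpace ℝ (Fin n)) : EuclideanSpace ℝ (Fin n) :=
  ∑ i, u i • coordField x (e i) p t

/-- In the chart at `p`, the second-order Taylor polynomial in `u` of `exp_{x(t)} (E_t u)`. -/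
def normalVariation
    (g : Bundle.ContMDiffRiemannianMetric (𝓡 n) ∞ (EuclideanSpace ℝ (Fin n))
      (fun q : M => TangentSpace (𝓡 n) q))
    (x : ℝ → M) (e : Fin n → (t : ℝ) → TangentSpace (𝓡 n) (x t)) (p : M) (t : ℝ)
    (u : EuclideanSpace ℝ (Fin n)) : EuclideanSpace ℝ (Fin n) :=
  coordCurve x p t + coordFrame x e p t u -
    (1 / 2 : ℝ) • christoffel g p (coordCurve x p t) (coordFrame x e p t u) (coordFrame x e p t u)

/-- The Lagrangian in the trivialization given by the frame: up to terms of third order in `(u, w)`,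
this is `L(t, exp_{x(t)} (E_t u), d/ds exp_{x(t+s)} (E_{t+s} (u + s w)))`, with the derivative
taken at `s = 0`. -/
def framedLagrangian
    (g : Bundle.ContMDiffRiemannianMetric (𝓡 n) ∞ (EuclideanSpace ℝ (Fin n))
      (fun q : M => TangentSpace (𝓡 n) q))
    (L : ℝ → TangentBundle (𝓡 n) M → ℝ)
    (x : ℝ → M) (e : Fin n → (t : ℝ) → TangentSpace (𝓡 n) (x t)) (t : ℝ)
    (u w : EuclideanSpace ℝ (Fin n)) : ℝ :=
  coordLagrangian L (x t) t (normalVariation g x e (x t) t u)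
    (deriv (fun s => normalVariation g x e (x t) (t + s) (u + s • w)) 0)

/-- The integrand of the second variation of the action along `x`, as a quadratic form in
`(u, u')`, where `ξ(t) = E_t u(t)` and `∇_t ξ = E_t u'`. -/
def secondVariation
    (g : Bundle.ContMDiffRiemannianMetric (𝓡 n) ∞ (EuclideanSpace ℝ (Fin n))
      (fun q : M => TangentSpace (𝓡 n) q))
    (L : ℝ → TangentBundle (𝓡 n) M → ℝ)
    (x : ℝ → M) (e : Fin n → (t : ℝ) → TangentSpace (𝓡 n) (x t)) (t : ℝ)
    (z : EuclideanSpace ℝ (Fin n) × EuclideanSpace ℝ (Fin n)) : ℝ :=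
  iteratedDeriv 2 (fun s : ℝ => framedLagrangian g L x e t (s • z.1) (s • z.2)) 0

/-- The symmetric bilinear form of `secondVariation`, that is, the Hessian of the framed Lagrangian
at the origin. -/
def secondVariationForm
    (g : Bundle.ContMDiffRiemannianMetric (𝓡 n) ∞ (EuclideanSpace ℝ (Fin n))
      (fun q : M => TangentSpace (𝓡 n) q))
    (L : ℝ → TangentBundle (𝓡 n) M → ℝ)
    (x : ℝ → M) (e : Fin n → (t : ℝ) → TangentSpace (𝓡 n) (x t)) (t : ℝ)
    (z z' : EuclideanSpace ℝ (Fin n) × EuclideanSpace ℝ (Fin n)) : ℝ :=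
  (secondVariation g L x e t (z + z') - secondVariation g L x e t z -
    secondVariation g L x e t z') / 2

/-- `P(t)`: the components of `∇_{vv} L(t, x(t), x'(t))` in the frame. -/
def matrixP
    (g : Bundle.ContMDiffRiemannianMetric (𝓡 n) ∞ (EuclideanSpace ℝ (Fin n))
      (fun q : M => TangentSpace (𝓡 n) q))
    (L : ℝ → TangentBundle (𝓡 n) M → ℝ)
    (x : ℝ → M) (e : Fin n → (t : ℝ) → TangentSpace (𝓡 n) (x t)) (t : ℝ) :
    Matrix (Fin n) (Fin n) ℝ :=
  Matrix.of fun i j => secondVariationForm g L x e t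
    (0, EuclideanSpace.single i 1) (0, EuclideanSpace.single j 1)

/-- `Q(t)`: the components of `∇_{qv} L(t, x(t), x'(t))` in the frame. -/
def matrixQ
    (g : Bundle.ContMDiffRiemannianMetric (𝓡 n) ∞ (EuclideanSpace ℝ (Fin n))
      (fun q : M => TangentSpace (𝓡 n) q))
    (L : ℝ → TangentBundle (𝓡 n) M → ℝ)
    (x : ℝ → M) (e : Fin n → (t : ℝ) → TangentSpace (𝓡 n) (x t)) (t : ℝ) :
    Matrix (Fin n) (Fin n) ℝ :=
  Matrix.of fun i j => secondVariationForm g L x e t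
    (0, EuclideanSpace.single i 1) (EuclideanSpace.single j 1, 0)

/-- `R(t)`: the components of `∇_{qq} L(t, x(t), x'(t))` in the frame. -/
def matrixR
    (g : Bundle.ContMDiffRiemannianMetric (𝓡 n) ∞ (EuclideanSpace ℝ (Fin n))
      (fun q : M => TangentSpace (𝓡 n) q))
    (L : ℝ → TangentBundle (𝓡 n) M → ℝ)
    (x : ℝ → M) (e : Fin n → (t : ℝ) → TangentSpace (𝓡 n) (x t)) (t : ℝ) :
    Matrix (Fin n) (Fin n) ℝ :=
  Matrix.of fun i j => secondVariationForm g L x e t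
    (EuclideanSpace.single i 1, 0) (EuclideanSpace.single j 1, 0)

/-- The coefficient matrix `B(t)` of the linear Hamiltonian system for `z = (P u' + Q u, u)`. -/
def matrixB
    (g : Bundle.ContMDiffRiemannianMetric (𝓡 n) ∞ (EuclideanSpace ℝ (Fin n))
      (fun q : M => TangentSpace (𝓡 n) q))
    (L : ℝ → TangentBundle (𝓡 n) M → ℝ)
    (x : ℝ → M) (e : Fin n → (t : ℝ) → TangentSpace (𝓡 n) (x t)) (t : ℝ) :
    Matrix (Fin n ⊕ Fin n) (Fin n ⊕ Fin n) ℝ :=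
  let P := matrixP g L x e t
  let Q := matrixQ g L x e t
  let R := matrixR g L x e t
  Matrix.fromBlocks P⁻¹ (-(P⁻¹ * Q)) (-(Q.transpose * P⁻¹)) (Q.transpose * P⁻¹ * Q - R)

/-- `ψ` is the fundamental solution on `[0, T]` of `z' = J B(t) z`, where `J = [0, -1; 1, 0]`. The
entries are differentiated one by one. -/
structure IsFundamentalSolution
    (g : Bundle.ContMDiffRiemannianMetric (𝓡 n) ∞ (EuclideanSpace ℝ (Fin n))
      (fun q : M => TangentSpace (𝓡 n) q))
    (T : ℝ) (L : ℝ → TangentBundle (𝓡 n) M → ℝ)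
    (x : ℝ → M) (e : Fin n → (t : ℝ) → TangentSpace (𝓡 n) (x t))
    (ψ : ℝ → Matrix (Fin n ⊕ Fin n) (Fin n ⊕ Fin n) ℝ) : Prop where
  initial : ψ 0 = 1
  equation : ∀ t ∈ Set.Icc 0 T, ∀ i j,
    HasDerivWithinAt (fun s => ψ s i j)
      ((Matrix.J (Fin n) ℝ * matrixB g L x e t * ψ t) i j) (Set.Icc 0 T) t

/-- `k` is the geometrical index `ι_CLM(Δ, Gr(A_d ψ(t)), t ∈ [0, T])` of `x`, computed in
`(ℝ²ⁿ × ℝ²ⁿ, -ω × ω)`. -/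
def IsGeometricalIndex
    (g : Bundle.ContMDiffRiemannianMetric (𝓡 n) ∞ (EuclideanSpace ℝ (Fin n))
      (fun q : M => TangentSpace (𝓡 n) q))
    (T : ℝ) (x : ℝ → M) (e : Fin n → (t : ℝ) → TangentSpace (𝓡 n) (x t))
    (ψ : ℝ → Matrix (Fin n ⊕ Fin n) (Fin n ⊕ Fin n) ℝ) (k : ℤ) : Prop :=
  IsCLMIndex (prodJ (Matrix.J (Fin n) ℝ)) (graph 1)
    (fun t => graph (holonomyDouble g T x e * ψ t)) 0 T k

/-- The orbit `x` is linearly unstable if its linearized Poincaré map, which is `A_d ψ(T)` in the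
frame, is not linearly stable. -/
def IsLinearlyUnstable
    (g : Bundle.ContMDiffRiemannianMetric (𝓡 n) ∞ (EuclideanSpace ℝ (Fin n))
      (fun q : M => TangentSpace (𝓡 n) q))
    (T : ℝ) (x : ℝ → M) (e : Fin n → (t : ℝ) → TangentSpace (𝓡 n) (x t))
    (ψ : ℝ → Matrix (Fin n ⊕ Fin n) (Fin n ⊕ Fin n) ℝ) : Prop :=
  ¬ IsLinearlyStable (holonomyDouble g T x e * ψ T)

end Manifold

end Lagrangian

end

/-! The argument is by parity: a linearly stable orbit has even index. Put S(t) = A_d ψ(t), a path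
of symplectic matrices. The rotated graph e^{-ε𝒥} Gr(S(t)) consists of the pairs (e^{εJ}z,
e^{-εJ}S(t)z), so it meets Δ exactly when D(t) = det(e^{-εJ}S(t) - e^{εJ}) = det(S(t) - e^{2εJ})
vanishes.

For a transverse path close to the rotated graphs, the analogous determinant has a simple zero at
each crossing. Modulo 2 the signed count is therefore the number of sign changes, and the index is
even as soon as D is positive at both end points (`even_signedCrossings`,
`IsIntersectionNumber.even_of_det_pos`).

The sign at the end points is computed in `eventually_det_pos`. If 1 is a semisimple eigenvalue of
the symplectic matrix S, then ℝ²ⁿ is the direct sum of ker(S - 1) and im(S - 1), which are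
symplectically orthogonal and hence both of even dimension. For small ε > 0 the kernel contributes a
positive factor, because J is compatible with the symplectic form. The image contributes det(S - 1)
restricted to it, which is positive when S has no real eigenvalue above 1. At t = T both spectral
conditions follow from linear stability; at t = 0 the matrix is A_d, and they follow from its
orthogonality. -/

noncomputable section

namespace Lagrangian

open Matrix

/-! ### Linear algebra: the sign of det(S - e^{2εJ}) for symplectic S. -/

/-- A real matrix whose kernel and image are complementary is similar to `diag(0, M)` with `M`
invertible. -/
theorem exists_block_diagonal {ι : Type} [Fintype ι] [DecidableEq ι] (K : Matrix ι ι ℝ)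
    (hK : ∀ v, K *ᵥ (K *ᵥ v) = 0 → K *ᵥ v = 0) :
    ∃ (d r : ℕ) (C : Matrix ι (Fin d ⊕ Fin r) ℝ) (D : Matrix (Fin d ⊕ Fin r) ι ℝ)
      (M : Matrix (Fin r) (Fin r) ℝ),
      D * C = 1 ∧ C * D = 1 ∧ D * K * C = fromBlocks 0 0 0 M ∧ M.det ≠ 0 := by
  set φ := Matrix.toLin' K with hφ
  have hdisj : Disjoint (LinearMap.ker φ) (LinearMap.range φ) := by
    rw [Submodule.disjoint_def]
    rintro _ h1 ⟨v, rfl⟩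
    exact hK v h1
  have hc : IsCompl (LinearMap.ker φ) (LinearMap.range φ) := by
    refine (Submodule.isCompl_iff_disjoint _ _ ?_).2 hdisj
    rw [add_comm, LinearMap.finrank_range_add_finrank_ker]
  set q := Submodule.prodEquivOfIsCompl _ _ hc with hq
  set b := ((Module.finBasis ℝ (LinearMap.ker φ)).prod
    (Module.finBasis ℝ (LinearMap.range φ))).map q with hb
  have hinl : ∀ w i, b.repr w (Sum.inl i) = (Module.finBasis ℝ _).repr (q.symm w).1 i := by
    intro w i; simp [hb]
  have hrange : ∀ w, w ∈ LinearMap.range φ ↔ ∀ i, b.repr w (Sum.inl i) = 0 := by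
    intro w
    rw [← Submodule.prodEquivOfIsCompl_symm_apply_fst_eq_zero _ _ hc, ← hq]
    simp only [hinl]
    constructor
    · intro h i; simp [h]
    · intro h
      apply (Module.finBasis ℝ (LinearMap.ker φ)).repr.injective
      ext i; simpa using h i
  set N := LinearMap.toMatrix b b φ with hN
  have hN11 : N.toBlocks₁₁ = 0 := by
    ext i j
    have := (hrange (φ (b (Sum.inl j)))).1 ⟨_, rfl⟩ i
    simpa [N, toBlocks₁₁, LinearMap.toMatrix_apply] using this
  have hN12 : N.toBlocks₁₂ = 0 := by
    ext i j
    have := (hrange (φ (b (Sum.inr j)))).1 ⟨_, rfl⟩ i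
    simpa [N, toBlocks₁₂, LinearMap.toMatrix_apply] using this
  have hN21 : N.toBlocks₂₁ = 0 := by
    ext i j
    have : φ (b (Sum.inl j)) = 0 := by
      have h : b (Sum.inl j) = (Module.finBasis ℝ (LinearMap.ker φ) j : ι → ℝ) := by
        simp [hb, hq]
      rw [h]; exact (Module.finBasis ℝ (LinearMap.ker φ) j).2
    simp [N, toBlocks₂₁, LinearMap.toMatrix_apply, this]
  have hNM : N = fromBlocks 0 0 0 N.toBlocks₂₂ := by
    conv_lhs => rw [← fromBlocks_toBlocks N, hN11, hN12, hN21]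
  refine ⟨_, _, (Pi.basisFun ℝ ι).toMatrix b, b.toMatrix (Pi.basisFun ℝ ι), N.toBlocks₂₂,
    Module.Basis.toMatrix_mul_toMatrix_flip _ _, Module.Basis.toMatrix_mul_toMatrix_flip _ _,
    ?_, ?_⟩
  · rw [← hNM, hN, ← basis_toMatrix_mul_linearMap_toMatrix_mul_basis_toMatrix
      b (Pi.basisFun ℝ ι) b (Pi.basisFun ℝ ι) φ]
    congr 2
    exact (LinearMap.toMatrix'_toLin' K).symm
  -- A null vector of the block `M` is a vector of the image killed by `K`, and kernel and image
  -- meet only in 0.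
  · intro h0
    obtain ⟨z, hz0, hz⟩ := exists_mulVec_eq_zero_iff.2 h0
    set w := b.equivFun.symm (Sum.elim (0 : Fin _ → ℝ) z) with hw
    have hrw : (b.repr w : _ → ℝ) = Sum.elim (0 : Fin _ → ℝ) z := by
      rw [← Module.Basis.equivFun_apply, hw, LinearEquiv.apply_symm_apply]
    have hφw : φ w = 0 := by
      apply b.repr.injective
      ext k
      have := congrFun (LinearMap.toMatrix_mulVec_repr b b φ w) k
      rw [← this, hrw, ← hN, hNM, fromBlocks_mulVec]
      rcases k with k | k <;> simp [hz]
    obtain ⟨y, hy⟩ := (hrange w).2 (fun i => by rw [hrw]; rfl)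
    have hw0 : w = 0 := by
      rw [← hy]; apply hK y
      have : φ (φ y) = 0 := by rw [hy, hφw]
      exact this
    apply hz0
    rw [hw0] at hrw
    ext k
    have := congrFun hrw (Sum.inr k)
    simpa using this.symm

/-- Deform Ω to the identity along s·1 + (1 - s)Ω. Since zᵀΩz = 0, a null vector z gives s|z|² = 0,
so the determinant cannot vanish for s > 0. -/
theorem det_nonneg_of_transpose_eq_neg {d : ℕ} (Ω : Matrix (Fin d) (Fin d) ℝ) (h : Ωᵀ = -Ω) :
    0 ≤ Ω.det := by
  by_contra! hneg
  have hc : ContinuousOn (fun s : ℝ => (s • (1 : Matrix (Fin d) (Fin d) ℝ) + (1 - s) • Ω).det)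
      (Set.Icc 0 1) := by fun_prop
  obtain ⟨s, hs, hs0⟩ := intermediate_value_Icc (zero_le_one) hc
    (show (0 : ℝ) ∈ Set.Icc _ _ by simp [hneg.le])
  obtain ⟨z, hz0, hz⟩ := exists_mulVec_eq_zero_iff.2 hs0
  have hskew : z ⬝ᵥ (Ω *ᵥ z) = 0 := by
    have : z ⬝ᵥ (Ω *ᵥ z) = -(z ⬝ᵥ (Ω *ᵥ z)) := by
      conv_lhs => rw [dotProduct_mulVec, ← mulVec_transpose, h, neg_mulVec, neg_dotProduct,
        dotProduct_comm]
    linarith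
  have hzz : 0 < z ⬝ᵥ z := by
    have := dotProduct_star_self_pos_iff (v := z)
    simpa using this.2 hz0
  have h1 : s * (z ⬝ᵥ z) = 0 := by
    have := congrArg (fun y => z ⬝ᵥ y) hz
    simpa [add_mulVec, smul_mulVec, dotProduct_add, hskew] using this
  rcases mul_eq_zero.1 h1 with h2 | h2
  · subst h2
    simp at hs0
    exact hneg.ne hs0
  · exact hzz.ne' h2

/-- The determinant never vanishes on the homotopy from -1 to N - 1, and det(-1) = 1 in even
dimension. -/
theorem det_pos_of_det_smul_sub_one_ne_zero {r : ℕ} (hr : Even r) (N : Matrix (Fin r) (Fin r) ℝ)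
    (h : ∀ s ∈ Set.Icc (0 : ℝ) 1, (s • N - 1).det ≠ 0) : 0 < (N - 1).det := by
  by_contra! hneg
  have hc : ContinuousOn (fun s : ℝ => (s • N - 1).det) (Set.Icc 0 1) := by fun_prop
  obtain ⟨s, hs, hs0⟩ := intermediate_value_Icc' (zero_le_one) hc
    (show (0 : ℝ) ∈ Set.Icc _ _ by simp [hneg, det_neg, hr.neg_one_pow])
  exact h s hs hs0

/-- Let `S` be symplectic, with `1` a semisimple eigenvalue and no real eigenvalue larger than `1`.
Then `det (S - e^{2εJ}) > 0` for small `ε > 0`. -/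
theorem eventually_det_pos {n : ℕ} (S : Matrix (Fin n ⊕ Fin n) (Fin n ⊕ Fin n) ℝ)
    (hS : Sᵀ * J (Fin n) ℝ * S = J (Fin n) ℝ)
    (hss : ∀ v, (S - 1) *ᵥ ((S - 1) *ᵥ v) = 0 → (S - 1) *ᵥ v = 0)
    (hreal : ∀ s ∈ Set.Ico (0 : ℝ) 1, (s • S - 1).det ≠ 0) :
    ∀ᶠ ε in 𝓝[>] (0 : ℝ),
      0 < (Real.cos ε • (S - 1) - Real.sin ε • (J (Fin n) ℝ * (S + 1))).det := by
  obtain ⟨d, r, C, D, M, hDC, hCD, hK, hM⟩ := exists_block_diagonal (S - 1) hss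
  set Jn := J (Fin n) ℝ with hJn
  have hcard : d + r = n + n := by
    have := Fintype.card_congr (indexEquivOfInv hDC hCD)
    simpa using this
  set N : Matrix (Fin d ⊕ Fin r) (Fin d ⊕ Fin r) ℝ := fromBlocks 0 0 0 M with hN
  have hKC : (S - 1) * C = C * N := by
    rw [← hK, ← Matrix.mul_assoc, ← Matrix.mul_assoc, hCD, Matrix.one_mul]
  have hdet : ∀ X : Matrix (Fin n ⊕ Fin n) (Fin n ⊕ Fin n) ℝ, (D * X * C).det = X.det :=
    fun X => det_conj_of_mul_eq_one hDC hCD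
  -- In the basis given by the columns of `C`, adapted to ker(S - 1) ⊕ im(S - 1), `Ω` is the Gram
  -- matrix of xᵀJy, `Z` the matrix of the endomorphism J, and `G` the Gram matrix of the inner
  -- product.
  set Ω := Cᵀ * Jn * C with hΩ
  set Z := D * Jn * C with hZ
  set G := Cᵀ * C with hG
  have hΩZ : Ω * Z = -G := by
    calc Ω * Z = Cᵀ * Jn * (C * D) * Jn * C := by simp only [hΩ, hZ, Matrix.mul_assoc]
      _ = Cᵀ * (Jn * Jn) * C := by rw [hCD]; simp only [Matrix.mul_assoc, Matrix.one_mul]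
      _ = -G := by rw [hJn, J_squared]; simp [hG]
  have hΩt : Ωᵀ = -Ω := by
    simp only [hΩ, transpose_mul, transpose_transpose, hJn, J_transpose, Matrix.mul_assoc]
    simp
  -- The relation SᵀJS = J rewritten for S - 1, in the adapted basis.
  have hΩK : Nᵀ * Ω + Ω * N + Nᵀ * Ω * N = 0 := by
    have h1 : (S - 1)ᵀ * Jn + Jn * (S - 1) + (S - 1)ᵀ * Jn * (S - 1) = 0 := by
      have : (S - 1)ᵀ * Jn + Jn * (S - 1) + (S - 1)ᵀ * Jn * (S - 1) = Sᵀ * Jn * S - Jn := by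
        simp only [transpose_sub, transpose_one]; noncomm_ring
      rw [this, hS, sub_self]
    have h2 : Nᵀ * Cᵀ = Cᵀ * (S - 1)ᵀ := by
      rw [← transpose_mul, ← transpose_mul, hKC]
    calc _ = Cᵀ * ((S - 1)ᵀ * Jn + Jn * (S - 1) + (S - 1)ᵀ * Jn * (S - 1)) * C := by
            simp only [hΩ, Matrix.mul_add, Matrix.add_mul]
            simp only [← Matrix.mul_assoc, h2]
            simp only [Matrix.mul_assoc, hKC]
      _ = 0 := by rw [h1]; simp
  -- The upper right block of `hΩK` reads Ω₁₂M = 0: kernel and image of S - 1 are symplectically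
  -- orthogonal.
  have hΩ12 : Ω.toBlocks₁₂ = 0 := by
    have h1 := hΩK
    rw [← fromBlocks_toBlocks Ω] at h1
    simp only [hN, fromBlocks_transpose, fromBlocks_multiply, fromBlocks_add] at h1
    have h2 := congrArg toBlocks₁₂ h1
    simp at h2
    have hu : IsUnit M.det := isUnit_iff_ne_zero.2 hM
    calc Ω.toBlocks₁₂ = Ω.toBlocks₁₂ * M * M⁻¹ := by rw [mul_nonsing_inv_cancel_right _ _ hu]
      _ = 0 := by
        have h3 : Ω.toBlocks₁₂ * M = 0 := h2
        rw [h3, Matrix.zero_mul]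
  have h11 : Ω.toBlocks₁₁ * Z.toBlocks₁₁ = -G.toBlocks₁₁ := by
    have h1 := hΩZ
    rw [← fromBlocks_toBlocks Ω, ← fromBlocks_toBlocks Z, fromBlocks_multiply, hΩ12] at h1
    have h2 := congrArg toBlocks₁₁ h1
    simp at h2
    rw [h2]; rfl
  have hGpos : 0 < G.toBlocks₁₁.det := by
    have hinj : Function.Injective C.mulVec := by
      intro u v huv
      have := congrArg (D *ᵥ ·) huv
      simpa [hDC] using this
    have hpd : G.PosDef := by
      have := Matrix.PosDef.conjTranspose_mul_self C hinj
      simpa [hG] using this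
    exact (hpd.submatrix (e := Sum.inl) Sum.inl_injective).det_pos
  have hΩ11t : (Ω.toBlocks₁₁)ᵀ = -Ω.toBlocks₁₁ := by
    ext i j
    exact congrFun (congrFun hΩt (Sum.inl i)) (Sum.inl j)
  have hprod : Ω.toBlocks₁₁.det * Z.toBlocks₁₁.det = (-1) ^ d * G.toBlocks₁₁.det := by
    rw [← det_mul, h11, det_neg, Fintype.card_fin]
  have hΩne : Ω.toBlocks₁₁.det ≠ 0 := by
    intro h
    rw [h, zero_mul] at hprod
    rcases mul_eq_zero.1 hprod.symm with h | h
    · exact pow_ne_zero _ (by norm_num) h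
    · exact hGpos.ne' h
  -- A skew-symmetric matrix of odd size is singular, whereas Ω₁₁ is invertible.
  have hd : Even d := by
    by_contra hodd
    have h1 := congrArg det hΩ11t
    rw [det_transpose, det_neg, Fintype.card_fin, (Nat.not_even_iff_odd.1 hodd).neg_one_pow] at h1
    exact hΩne (by linarith)
  have hr : Even r := by
    have : Even (d + r) := hcard ▸ ⟨n, rfl⟩
    exact (Nat.even_add.1 this).1 hd
  have hZpos : 0 < Z.toBlocks₁₁.det := by
    have hΩpos := lt_of_le_of_ne (det_nonneg_of_transpose_eq_neg _ hΩ11t) hΩne.symm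
    rw [hd.neg_one_pow, one_mul] at hprod
    exact pos_of_mul_pos_right (hprod ▸ hGpos) hΩpos.le
  -- `M + 1` is S restricted to im(S - 1). For s < 1 the hypothesis on real eigenvalues applies; at
  -- s = 1 the matrix is `M` itself.
  have hMpos : 0 < M.det := by
    have := det_pos_of_det_smul_sub_one_ne_zero hr (M + 1) ?_
    · simpa using this
    intro s hs
    rcases eq_or_lt_of_le hs.2 with h1 | h1
    · subst h1; simpa using hM
    have h2 := hreal s ⟨hs.1, h1⟩
    rw [← hdet] at h2
    have h3 : D * (s • S - 1) * C = fromBlocks ((s - 1) • 1) 0 0 (s • (M + 1) - 1) := by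
      have : s • S - 1 = s • (S - 1) + (s - 1) • (1 : Matrix _ _ ℝ) := by
        rw [smul_sub, sub_smul, one_smul]; abel
      rw [this, Matrix.mul_add, Matrix.add_mul, Matrix.mul_smul, Matrix.smul_mul, hK, hN,
        Matrix.mul_smul, Matrix.mul_one, Matrix.smul_mul, hDC, ← fromBlocks_one,
        fromBlocks_smul, fromBlocks_smul, fromBlocks_add]
      congr 1
      · simp
      · simp
      · simp
      · rw [smul_add, sub_smul, one_smul]; abel
    rw [h3, det_fromBlocks_zero₂₁] at h2
    exact right_ne_zero_of_mul h2
  -- On ker(S - 1) the matrix under study reduces to -2 sin ε · J, so sin ε factors out of the first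
  -- `d` columns; `Y` is what remains. `Y 0` is block triangular with diagonal blocks -2Z₁₁ and `M`.
  set Y : ℝ → Matrix (Fin d ⊕ Fin r) (Fin d ⊕ Fin r) ℝ := fun ε =>
    fromBlocks ((-2 : ℝ) • Z.toBlocks₁₁) (-(Real.sin ε • (Z.toBlocks₁₂ * (M + 2))))
      ((-2 : ℝ) • Z.toBlocks₂₁) (Real.cos ε • M - Real.sin ε • (Z.toBlocks₂₂ * (M + 2))) with hY
  have hfac : ∀ ε, (Real.cos ε • (S - 1) - Real.sin ε • (Jn * (S + 1))).det
      = (Y ε).det * Real.sin ε ^ d := by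
    intro ε
    set N' : Matrix (Fin d ⊕ Fin r) (Fin d ⊕ Fin r) ℝ := fromBlocks 2 0 0 (M + 2) with hN'
    have h1 : D * (Jn * (S + 1)) * C = Z * N' := by
      have : (S + 1) * C = C * N' := by
        have e1 : S + 1 = (S - 1) + (2 : ℝ) • 1 := by
          rw [two_smul]; abel
        have e2 : N' = N + (2 : ℝ) • 1 := by
          rw [hN, hN', ← fromBlocks_one, fromBlocks_smul, fromBlocks_add]
          congr 1 <;> simp [two_smul, one_add_one_eq_two]
        rw [e1, e2, Matrix.add_mul, hKC, Matrix.mul_add]; simp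
      rw [Matrix.mul_assoc, Matrix.mul_assoc, this, hZ]; simp only [Matrix.mul_assoc]
    have h2 : D * (Real.cos ε • (S - 1) - Real.sin ε • (Jn * (S + 1))) * C
        = Y ε * fromBlocks (Real.sin ε • 1) 0 0 1 := by
      rw [Matrix.mul_sub, Matrix.sub_mul, Matrix.mul_smul, Matrix.smul_mul, Matrix.mul_smul,
        Matrix.smul_mul, hK, h1]
      conv_lhs => rw [← fromBlocks_toBlocks Z]
      have e2 : (2 : Matrix (Fin d) (Fin d) ℝ) = (2 : ℝ) • 1 := by
        rw [two_smul, one_add_one_eq_two]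
      simp only [hY, hN, hN', fromBlocks_multiply, fromBlocks_smul, sub_eq_add_neg, fromBlocks_neg,
        fromBlocks_add, e2]
      congr 1 <;> simp [smul_smul, mul_comm]
    rw [← hdet, h2, det_mul, det_fromBlocks_zero₂₁, det_smul]
    simp
  have hYc : Continuous fun ε => (Y ε).det := by
    simp only [hY]
    apply Continuous.matrix_det
    apply Continuous.matrix_fromBlocks <;> fun_prop
  have hY0 : 0 < (Y 0).det := by
    simp only [hY, Real.sin_zero, Real.cos_zero, zero_smul, neg_zero, sub_zero, one_smul]
    rw [det_fromBlocks_zero₁₂, det_smul, Fintype.card_fin]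
    exact mul_pos (mul_pos (hd.pow_pos (by norm_num)) hZpos) hMpos
  have h1 : ∀ᶠ ε in 𝓝[>] (0 : ℝ), 0 < (Y ε).det :=
    nhdsWithin_le_nhds (hYc.continuousAt.eventually (lt_mem_nhds hY0))
  have h2 : ∀ᶠ ε in 𝓝[>] (0 : ℝ), ε ∈ Set.Ioo 0 Real.pi :=
    Ioo_mem_nhdsGT Real.pi_pos
  filter_upwards [h1, h2] with ε h1 h2
  rw [hfac]
  exact mul_pos h1 (pow_pos (Real.sin_pos_of_mem_Ioo h2) _)

/-! ### Simple zeros, and the derivative of a determinant at a singular point. -/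

/-- A continuous function on `[a, b]` with finitely many zeros, all of them simple and interior,
changes sign from `a` to `b` according to the parity of the number of zeros. -/
theorem neg_one_pow_card_zeros_mul_pos {a b : ℝ} (hab : a ≤ b) (Z : Finset ℝ) :
    ∀ f : ℝ → ℝ, ContinuousOn f (Set.Icc a b) → (∀ t ∈ Set.Icc a b, f t = 0 ↔ t ∈ Z) →
      (∀ t ∈ Z, t ∈ Set.Ioo a b ∧ ∃ f', f' ≠ 0 ∧ HasDerivAt f f' t) →
      0 < (-1) ^ Z.card * (f a * f b) := by
  induction Z using Finset.induction_on with
  | empty =>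
    intro f hf h0 _
    simp only [Finset.card_empty, pow_zero, one_mul]
    by_contra! hneg
    rw [← Set.uIcc_of_le hab] at hf
    have h0mem : (0 : ℝ) ∈ Set.uIcc (f a) (f b) := by
      rw [Set.mem_uIcc]
      rcases mul_nonpos_iff.1 hneg with h | h
      · exact Or.inr ⟨h.2, h.1⟩
      · exact Or.inl ⟨h.1, h.2⟩
    obtain ⟨t, ht, hft⟩ := intermediate_value_uIcc hf h0mem
    rw [Set.uIcc_of_le hab] at ht
    exact absurd ((h0 t ht).1 hft) (Finset.notMem_empty t)
  | insert c Z hc ih =>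
    intro f hf h0 hd
    obtain ⟨hcab, f', hf', hcd⟩ := hd c (Finset.mem_insert_self c Z)
    have hfc : f c = 0 :=
      (h0 c (Set.Ioo_subset_Icc_self hcab)).2 (Finset.mem_insert_self c Z)
    have hval : ∀ t, t ≠ c → dslope f c t = (t - c)⁻¹ * f t := by
      intro t ht
      rw [dslope_of_ne _ ht, slope_def_field, hfc, sub_zero, div_eq_inv_mul]
    -- Dividing by t - c removes the zero at `c` and keeps the others simple; (a - c)(b - c) < 0
    -- accounts for one change of sign.
    have key := ih (dslope f c)
      ((continuousOn_dslope (Icc_mem_nhds hcab.1 hcab.2)).2 ⟨hf, hcd.differentiableAt⟩) ?_ ?_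
    · rw [hval a hcab.1.ne, hval b hcab.2.ne'] at key
      rw [Finset.card_insert_of_notMem hc, pow_succ]
      have h1 : 0 < -((a - c) * (b - c)) := by
        nlinarith [mul_pos (sub_pos.2 hcab.1) (sub_pos.2 hcab.2)]
      have h2 : a - c ≠ 0 := sub_ne_zero.2 hcab.1.ne
      have h3 : b - c ≠ 0 := sub_ne_zero.2 hcab.2.ne'
      have h4 := mul_pos h1 key
      have h5 : -((a - c) * (b - c)) * ((-1) ^ Z.card * ((a - c)⁻¹ * f a * ((b - c)⁻¹ * f b)))
          = (-1) ^ Z.card * -1 * (f a * f b) := by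
        field_simp
      rwa [h5] at h4
    · intro t ht
      rcases eq_or_ne t c with rfl | htc
      · rw [dslope_same, hcd.deriv]
        exact iff_of_false hf' hc
      · rw [hval t htc, mul_eq_zero, or_iff_right (inv_ne_zero (sub_ne_zero.2 htc)), h0 t ht,
          Finset.mem_insert, or_iff_right htc]
    · intro t ht
      obtain ⟨htab, g', hg', htd⟩ := hd t (Finset.mem_insert_of_mem ht)
      have htc : t ≠ c := fun h => hc (h ▸ ht)
      have hft : f t = 0 :=
        (h0 t (Set.Ioo_subset_Icc_self htab)).2 (Finset.mem_insert_of_mem ht)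
      refine ⟨htab, (t - c)⁻¹ * g', mul_ne_zero (inv_ne_zero (sub_ne_zero.2 htc)) hg', ?_⟩
      have h1 := ((((hasDerivAt_id t).sub_const c).inv (sub_ne_zero.2 htc)).mul htd)
      simp only [hft, mul_zero, zero_add] at h1
      refine HasDerivAt.congr_of_eventuallyEq h1 ?_
      filter_upwards [isOpen_ne.mem_nhds htc] with s hs
      rw [hval s hs]; rfl

/-- The derivative of the determinant at an endomorphism with `X t₀ u = 0`. -/
theorem hasDerivAt_det_of_apply_eq_zero {V : Type*} [NormedAddCommGroup V] [NormedSpace ℝ V]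
    [FiniteDimensional ℝ V] {X : ℝ → V →L[ℝ] V} {X' : V →L[ℝ] V} {t₀ : ℝ}
    (hX : HasDerivAt X X' t₀) {u : V} (hu : X t₀ u = 0) {φ : V →L[ℝ] ℝ} (hφ : φ u = 1) :
    HasDerivAt (fun t => (X t).det) (X t₀ + φ.smulRight (X' u)).det t₀ := by
  have hdet0 : (X t₀).det = 0 := by
    refine LinearMap.det_eq_zero_iff_ker_ne_bot.2 fun h => ?_
    have hu0 : u = 0 := LinearMap.ker_eq_bot'.1 h u hu
    simp [hu0] at hφ
  have hXu : HasDerivAt (fun t => X t u) (X' u) t₀ := by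
    simpa using hX.clm_apply (hasDerivAt_const t₀ u)
  rw [hasDerivAt_iff_tendsto_slope] at hXu ⊢
  have h1 : Filter.Tendsto (fun t => (X t + φ.smulRight (slope (fun t => X t u) t₀ t - X t u)).det)
      (𝓝[≠] t₀) (𝓝 (X t₀ + φ.smulRight (X' u)).det) := by
    refine (ContinuousLinearMap.continuous_det.tendsto _).comp ?_
    have hXc : Filter.Tendsto X (𝓝[≠] t₀) (𝓝 (X t₀)) :=
      hX.continuousAt.tendsto.mono_left nhdsWithin_le_nhds
    have hXuc : Filter.Tendsto (fun t => X t u) (𝓝[≠] t₀) (𝓝 0) := by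
      rw [← hu]
      exact (hX.continuousAt.clm_apply continuousAt_const).tendsto.mono_left nhdsWithin_le_nhds
    refine hXc.add ?_
    have h2 := hXu.sub hXuc
    rw [sub_zero] at h2
    exact ((ContinuousLinearMap.smulRightL ℝ V V φ).continuous.tendsto _).comp h2
  refine h1.congr' ?_
  filter_upwards [self_mem_nhdsWithin] with t ht
  have htne : t - t₀ ≠ 0 := sub_ne_zero.2 ht
  -- Precomposing X(t) with the transvection that multiplies `u` by (t - t₀)⁻¹ divides det X(t) by t
  -- - t₀. The difference quotient is thus itself a determinant, with a limit since X(t₀)u = 0.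
  have h3 : ((X t + φ.smulRight (slope (fun t => X t u) t₀ t - X t u) : V →L[ℝ] V) : V →ₗ[ℝ] V)
      = (X t : V →ₗ[ℝ] V) ∘ₗ
        LinearMap.transvection (φ : V →ₗ[ℝ] ℝ) (((t - t₀)⁻¹ - 1) • u) := by
    ext z
    simp [LinearMap.transvection.apply, slope_def_module, hu, sub_smul]
  rw [ContinuousLinearMap.det, h3, LinearMap.det_comp, LinearMap.transvection.det,
    slope_def_field, hdet0, sub_zero]
  simp only [map_smul, ContinuousLinearMap.coe_coe, hφ, smul_eq_mul, mul_one]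
  rw [add_sub_cancel, div_eq_mul_inv]

/-! ### Parity of the signed number of crossings. -/

/-- If two subspaces are at gap distance less than `1`, the orthogonal projection onto the first
one is injective on the second one. -/
theorem eq_zero_of_starProjection_eq_zero {κ : Type} [Fintype κ]
    {U₁ U₂ : Submodule ℝ (EuclideanSpace ℝ κ)}
    (h : ‖U₁.starProjection - U₂.starProjection‖ < 1) {v : EuclideanSpace ℝ κ} (hv : v ∈ U₂)
    (h0 : U₁.starProjection v = 0) : v = 0 := by
  by_contra hne
  have h1 := (U₁.starProjection - U₂.starProjection).le_opNorm v
  have h2 : U₂.starProjection v = v := Submodule.starProjection_eq_self_iff.2 hv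
  rw [_root_.sub_apply, h0, h2, zero_sub, norm_neg] at h1
  have h3 : 0 < ‖v‖ := norm_pos_iff.2 hne
  nlinarith

section Crossings

variable {κ : Type} [Fintype κ] [DecidableEq κ] {𝒥 : Matrix κ κ ℝ}
  {W : Submodule ℝ (EuclideanSpace ℝ κ)} {m : ℝ → Submodule ℝ (EuclideanSpace ℝ κ)} {a b : ℝ}

theorem crossingForm_smul (t c : ℝ) (v : EuclideanSpace ℝ κ) :
    crossingForm 𝒥 m a b t (c • v) = c ^ 2 * crossingForm 𝒥 m a b t v := by
  unfold crossingForm symplForm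
  have h : (fun s => (m s).starProjection (c • v)) = c • fun s => (m s).starProjection v := by
    ext1 s; simp
  rw [h, derivWithin_const_smul_field, map_smul, real_inner_smul_left, real_inner_smul_right]
  ring

/-- The signed number of crossings has the parity of the number of crossings. -/
theorem even_signedCrossings_iff (hm : IsTransversePath 𝒥 W m a b) :
    Even (signedCrossings 𝒥 W m a b) ↔ Even {t ∈ Set.Icc a b | m t ⊓ W ≠ ⊥}.ncard := by
  set A := {t ∈ Set.Icc a b | ∃ v ∈ m t ⊓ W, 0 < crossingForm 𝒥 m a b t v} with hA
  set B := {t ∈ Set.Icc a b | ∃ v ∈ m t ⊓ W, crossingForm 𝒥 m a b t v < 0} with hB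
  have hzero : ∀ t, crossingForm 𝒥 m a b t 0 = 0 := fun t => by
    simpa using crossingForm_smul (𝒥 := 𝒥) (m := m) (a := a) (b := b) t 0 0
  have hunion : A ∪ B = {t ∈ Set.Icc a b | m t ⊓ W ≠ ⊥} := by
    ext t
    constructor
    · rintro (⟨ht, v, hv, hpos⟩ | ⟨ht, v, hv, hpos⟩)
      all_goals
        refine ⟨ht, (Submodule.ne_bot_iff _).2 ⟨v, hv, ?_⟩⟩
        rintro rfl
        simp [hzero] at hpos
    · rintro ⟨ht, hne⟩
      obtain ⟨v, hv, hv0⟩ := (Submodule.ne_bot_iff _).1 hne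
      rcases lt_or_gt_of_ne (hm.transverse t ht v hv hv0) with h | h
      · exact Or.inr ⟨ht, v, hv, h⟩
      · exact Or.inl ⟨ht, v, hv, h⟩
  -- On a line the crossing form is a multiple of a square, so it cannot take both signs.
  have hdisj : Disjoint A B := by
    rw [Set.disjoint_left]
    rintro t ⟨ht, v, hv, hpos⟩ ⟨-, w, hw, hneg⟩
    obtain ⟨⟨e, he⟩, hspan⟩ := finrank_le_one_iff.1 (hm.simple t ht)
    obtain ⟨c₁, h₁⟩ := hspan ⟨v, hv⟩
    obtain ⟨c₂, h₂⟩ := hspan ⟨w, hw⟩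
    have h₁' : v = c₁ • e := (congrArg Subtype.val h₁).symm
    have h₂' : w = c₂ • e := (congrArg Subtype.val h₂).symm
    rw [h₁', crossingForm_smul] at hpos
    rw [h₂', crossingForm_smul] at hneg
    have h₃ := pos_of_mul_pos_right hpos (sq_nonneg _)
    exact absurd hneg (not_lt.2 (mul_nonneg (sq_nonneg _) h₃.le))
  have hfin := hm.finite
  rw [← hunion, Set.finite_union] at hfin
  rw [← hunion, Set.ncard_union_eq hdisj hfin.1 hfin.2]
  unfold signedCrossings
  rw [← hA, ← hB, Int.even_sub, Nat.even_add, Int.even_coe_nat, Int.even_coe_nat]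

/-- Let `F t` be a frame of a subspace at gap distance less than `1` from `m t`, and let `π` be a
linear map with kernel `W`. If the determinant of `π` on the projected frame of `m t` is positive
at both end points, then the signed number of crossings is even. -/
theorem even_signedCrossings {V : Type*} [NormedAddCommGroup V] [InnerProductSpace ℝ V]
    [FiniteDimensional ℝ V] (hab : a < b) (hm : IsTransversePath 𝒥 W m a b)
    (π : EuclideanSpace ℝ κ →L[ℝ] V) (hπ : ∀ y, π y = 0 ↔ y ∈ W)
    (hω : ∀ v ∈ W, ∃ ρ : V →ₗ[ℝ] ℝ, ∀ y, symplForm 𝒥 v y = ρ (π y))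
    (F : ℝ → V →L[ℝ] EuclideanSpace ℝ κ) (hF : DifferentiableOn ℝ F (Set.Icc a b))
    (hinj : ∀ t ∈ Set.Icc a b, Function.Injective (F t))
    (hclose : ∀ t ∈ Set.Icc a b,
      ‖(m t).starProjection - (LinearMap.range (F t : V →ₗ[ℝ] _)).starProjection‖ < 1)
    (hpos_a : 0 < (π ∘L (m a).starProjection ∘L F a).det)
    (hpos_b : 0 < (π ∘L (m b).starProjection ∘L F b).det) :
    Even (signedCrossings 𝒥 W m a b) := by
  rw [even_signedCrossings_iff hm]
  set P : ℝ → EuclideanSpace ℝ κ →L[ℝ] EuclideanSpace ℝ κ := fun t => (m t).starProjection with hP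
  set X : ℝ → V →L[ℝ] V := fun t => π ∘L P t ∘L F t with hX
  have hPd : DifferentiableOn ℝ P (Set.Icc a b) := hm.contDiffOn.differentiableOn one_ne_zero
  have hXd : DifferentiableOn ℝ X (Set.Icc a b) :=
    (differentiableOn_const π).clm_comp (hPd.clm_comp hF)
  have hPF : ∀ t ∈ Set.Icc a b, ∀ u, P t (F t u) = 0 → u = 0 := by
    intro t ht u hu
    refine hinj t ht ?_
    rw [map_zero]
    exact eq_zero_of_starProjection_eq_zero (hclose t ht) ⟨u, rfl⟩ hu
  -- Each of the two orthogonal projections, from one subspace to the other, is injective. The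
  -- dimensions therefore agree, and P(t)F(t) is a frame of `m t`.
  have hsurj : ∀ t ∈ Set.Icc a b, ∀ w ∈ m t, ∃ u, P t (F t u) = w := by
    intro t ht w hw
    set φ : V →ₗ[ℝ] m t := LinearMap.codRestrict (m t) (P t ∘L F t : V →L[ℝ] _)
      (fun u => Submodule.starProjection_apply_mem _ _) with hφ
    have hφinj : Function.Injective φ := by
      rw [← LinearMap.ker_eq_bot, LinearMap.ker_eq_bot']
      intro u hu
      exact hPF t ht u (congrArg Subtype.val hu)
    set χ : m t →ₗ[ℝ] LinearMap.range (F t : V →ₗ[ℝ] EuclideanSpace ℝ κ) :=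
      LinearMap.codRestrict _
        ((LinearMap.range (F t : V →ₗ[ℝ] EuclideanSpace ℝ κ)).starProjection.toLinearMap ∘ₗ
          (m t).subtype) (fun u => Submodule.starProjection_apply_mem _ _) with hχ
    have hχinj : Function.Injective χ := by
      rw [← LinearMap.ker_eq_bot, LinearMap.ker_eq_bot']
      intro u hu
      have h := hclose t ht
      rw [norm_sub_rev] at h
      exact Subtype.ext (eq_zero_of_starProjection_eq_zero h u.2 (congrArg Subtype.val hu))
    have h1 := LinearMap.finrank_le_finrank_of_injective hφinj
    have h2 := LinearMap.finrank_le_finrank_of_injective hχinj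
    have h3 := LinearMap.finrank_range_le (F t : V →ₗ[ℝ] EuclideanSpace ℝ κ)
    obtain ⟨u, hu⟩ := (LinearMap.injective_iff_surjective_of_finrank_eq_finrank
      (le_antisymm h1 (h2.trans h3))).1 hφinj ⟨w, hw⟩
    exact ⟨u, congrArg Subtype.val hu⟩
  have hker : ∀ t, (X t).det = 0 ↔ ∃ u, u ≠ 0 ∧ X t u = 0 := by
    intro t
    rw [ContinuousLinearMap.det, LinearMap.det_eq_zero_iff_ker_ne_bot, Submodule.ne_bot_iff]
    exact exists_congr fun u => and_comm
  have hzero : ∀ t ∈ Set.Icc a b, (X t).det = 0 ↔ m t ⊓ W ≠ ⊥ := by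
    intro t ht
    rw [hker, Submodule.ne_bot_iff]
    constructor
    · rintro ⟨u, hu0, hu⟩
      exact ⟨P t (F t u), ⟨Submodule.starProjection_apply_mem _ _, (hπ _).1 hu⟩,
        fun h => hu0 (hPF t ht u h)⟩
    · rintro ⟨w, hw, hw0⟩
      obtain ⟨u, rfl⟩ := hsurj t ht w hw.1
      refine ⟨u, ?_, (hπ _).2 hw.2⟩
      rintro rfl
      simp at hw0
  have hmem : ∀ t ∈ Set.Icc a b, (X t).det = 0 ↔ t ∈ hm.finite.toFinset := by
    intro t ht
    rw [hzero t ht, Set.Finite.mem_toFinset]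
    exact ⟨fun h => ⟨ht, h⟩, fun h => h.2⟩
  have hderiv : ∀ t ∈ hm.finite.toFinset, t ∈ Set.Ioo a b ∧
      ∃ f', f' ≠ 0 ∧ HasDerivAt (fun s => (X s).det) f' t := by
    intro t htZ
    have ht : t ∈ Set.Icc a b := ((Set.Finite.mem_toFinset _).1 htZ).1
    have hXt : (X t).det = 0 := (hmem t ht).2 htZ
    have hta : a ≠ t := by rintro rfl; exact hpos_a.ne' hXt
    have htb : t ≠ b := by rintro rfl; exact hpos_b.ne' hXt
    have htI : t ∈ Set.Ioo a b := ⟨lt_of_le_of_ne ht.1 hta, lt_of_le_of_ne ht.2 htb⟩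
    have hnhds : Set.Icc a b ∈ 𝓝 t := Icc_mem_nhds htI.1 htI.2
    obtain ⟨u, hu0, hu⟩ := (hker t).1 hXt
    set v := P t (F t u) with hv
    have hvm : v ∈ m t := Submodule.starProjection_apply_mem _ _
    have hvW : v ∈ W := (hπ _).1 hu
    have hv0 : v ≠ 0 := fun h => hu0 (hPF t ht u h)
    obtain ⟨ρ, hρ⟩ := hω v hvW
    have hdP := ((hPd t ht).differentiableAt hnhds).hasDerivAt
    have hdF := ((hF t ht).differentiableAt hnhds).hasDerivAt
    set P' := deriv P t
    set F' := deriv F t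
    have hdX : HasDerivAt X (π ∘L (P' ∘L F t + P t ∘L F')) t := by
      simpa using (hasDerivAt_const t π).clm_comp (hdP.clm_comp hdF)
    have hlag : ∀ y ∈ m t, symplForm 𝒥 v y = 0 := fun y hy =>
      (hm.lagrangian t ht y).1 hy v hvm
    have hcross : crossingForm 𝒥 m a b t v = ρ (π (P' v)) := by
      rw [crossingForm, ← hρ]
      congr 1
      rw [derivWithin_of_mem_nhds hnhds]
      simpa using (hdP.clm_apply (hasDerivAt_const t v)).deriv
    -- Differentiating P² = P gives P' = P'P + PP', so P' = PP' on ker P.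
    have hP' : ∀ y, P t y = 0 → P' y ∈ m t := by
      intro y hy
      have hidem : (fun s => P s ∘L P s) = P := by
        ext1 s
        ext1 z
        exact Submodule.starProjection_eq_self_iff.2 (Submodule.starProjection_apply_mem _ _)
      have h1 := hdP.clm_comp hdP
      rw [hidem] at h1
      have h2 := congrArg (fun Q : EuclideanSpace ℝ κ →L[ℝ] EuclideanSpace ℝ κ => Q y)
        (hdP.unique h1)
      have h3 : P' y = P t (P' y) := by simpa [hy] using h2
      rw [h3]
      exact Submodule.starProjection_apply_mem _ _
    -- F(t)u differs from v by a vector of ker P. That difference and the derivative of F contribute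
    -- only vectors of the Lagrangian `m t`, on which ω(v, ·) vanishes; what is left is the crossing
    -- form.
    have hρX : ρ (π ((P' ∘L F t + P t ∘L F') u)) = crossingForm 𝒥 m a b t v := by
      have h1 : (P' ∘L F t + P t ∘L F') u = P' v + P' (F t u - v) + P t (F' u) := by
        simp
      have h2 : P t (F t u - v) = 0 := by
        rw [map_sub, sub_eq_zero, hv]
        exact (Submodule.starProjection_eq_self_iff.2 hvm).symm
      rw [h1, map_add, map_add, map_add, map_add, ← hρ (P' (F t u - v)), ← hρ (P t (F' u)),
        hlag _ (hP' _ h2), hlag _ (Submodule.starProjection_apply_mem _ _), hcross]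
      ring
    have hne : ρ (π ((P' ∘L F t + P t ∘L F') u)) ≠ 0 := by
      rw [hρX]; exact hm.transverse t ht v ⟨hvm, hvW⟩ hv0
    set φ : V →L[ℝ] ℝ := (‖u‖ ^ 2)⁻¹ • innerSL ℝ u with hφdef
    have hφ : φ u = 1 := by
      have : ‖u‖ ^ 2 ≠ 0 := pow_ne_zero _ (norm_ne_zero_iff.2 hu0)
      simp [hφdef, this]
    refine ⟨htI, _, ?_, hasDerivAt_det_of_apply_eq_zero hdX hu hφ⟩
    -- The derivative of the determinant is nonzero: ρ vanishes on the range of X(t) but not on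
    -- X'(t)u, and ker X(t) is the line spanned by `u` because m(t) ∩ W has dimension one.
    rw [ContinuousLinearMap.det, Ne, LinearMap.det_eq_zero_iff_ker_ne_bot, not_not,
      LinearMap.ker_eq_bot']
    intro z hz
    have hz' : X t z + φ z • π ((P' ∘L F t + P t ∘L F') u) = 0 := hz
    have hρz : ρ (X t z) = 0 := by
      rw [← hlag _ (Submodule.starProjection_apply_mem (m t) (F t z)), hρ]; rfl
    have h1 := congrArg ρ hz'
    rw [map_add, map_smul, hρz, zero_add, map_zero, smul_eq_mul, mul_eq_zero,
      or_iff_left hne] at h1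
    rw [h1, zero_smul, add_zero] at hz'
    have hzW : P t (F t z) ∈ m t ⊓ W :=
      ⟨Submodule.starProjection_apply_mem _ _, (hπ _).1 hz'⟩
    obtain ⟨⟨e, he⟩, hspan⟩ := finrank_le_one_iff.1 (hm.simple t ht)
    obtain ⟨c₁, h₁⟩ := hspan ⟨v, hvm, hvW⟩
    obtain ⟨c₂, h₂⟩ := hspan ⟨_, hzW⟩
    have h₁' : c₁ • e = v := congrArg Subtype.val h₁
    have h₂' : c₂ • e = P t (F t z) := congrArg Subtype.val h₂
    have hc₁ : c₁ ≠ 0 := by rintro rfl; exact hv0 (by rw [← h₁', zero_smul])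
    have hzu : z = (c₂ / c₁) • u := by
      rw [← sub_eq_zero]
      refine hPF t ht _ ?_
      rw [map_sub, map_sub, map_smul, map_smul, ← hv, ← h₂', ← h₁', smul_smul,
        div_mul_cancel₀ _ hc₁, sub_self]
    rw [hzu, map_smul, hφ, smul_eq_mul, mul_one] at h1
    rw [hzu, h1, zero_smul]
  have hcont : ContinuousOn (fun s => (X s).det) (Set.Icc a b) :=
    ContinuousLinearMap.continuous_det.comp_continuousOn hXd.continuousOn
  have hfinal := neg_one_pow_card_zeros_mul_pos hab.le _ _ hcont hmem hderiv
  rw [Set.ncard_eq_toFinset_card _ hm.finite]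
  by_contra hodd
  rw [(Nat.not_even_iff_odd.1 hodd).neg_one_pow] at hfinal
  have := mul_pos hpos_a hpos_b
  simp only [hX, hP] at hfinal
  linarith

end Crossings

/-! ### Rotated graphs and the diagonal. -/

/-- Since 𝒥² = -1, sending i to 𝒥 is an algebra homomorphism from ℂ; it carries Euler's formula over
to matrices. -/
theorem exp_neg_smul_of_sq_eq_neg_one {κ : Type} [Fintype κ] [DecidableEq κ] {𝒥 : Matrix κ κ ℝ}
    (h𝒥 : 𝒥 * 𝒥 = -1) (ε : ℝ) :
    NormedSpace.exp (-(ε • 𝒥)) = Real.cos ε • (1 : Matrix κ κ ℝ) - Real.sin ε • 𝒥 := by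
  let _ : NormedRing (Matrix κ κ ℝ) := Matrix.linftyOpNormedRing
  let _ : NormedAlgebra ℝ (Matrix κ κ ℝ) := Matrix.linftyOpNormedAlgebra
  set f : ℂ →ₐ[ℝ] Matrix κ κ ℝ := Complex.lift ⟨𝒥, h𝒥⟩ with hf
  have hval : ∀ z : ℂ, f z = z.re • (1 : Matrix κ κ ℝ) + z.im • 𝒥 := by
    intro z
    simp [hf, Complex.liftAux_apply, Algebra.algebraMap_eq_smul_one]
  have hcont : Continuous f := f.toLinearMap.continuous_of_finiteDimensional
  have h1 : f (NormedSpace.exp (-(ε : ℂ) * Complex.I))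
      = NormedSpace.exp (f (-(ε : ℂ) * Complex.I)) :=
    NormedSpace.map_exp f hcont _
  rw [hval (-(ε : ℂ) * Complex.I), ← Complex.exp_eq_exp_ℂ, hval] at h1
  have h2 : (Complex.exp (-(ε : ℂ) * Complex.I)).re = Real.cos ε := by
    rw [← Complex.ofReal_neg, Complex.exp_ofReal_mul_I_re, Real.cos_neg]
  have h3 : (Complex.exp (-(ε : ℂ) * Complex.I)).im = -Real.sin ε := by
    rw [← Complex.ofReal_neg, Complex.exp_ofReal_mul_I_im, Real.sin_neg]
  rw [h2, h3] at h1
  simp only [Complex.neg_re, Complex.mul_re, Complex.ofReal_re, Complex.I_re, mul_zero,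
    Complex.neg_im, Complex.ofReal_im, Complex.I_im, neg_zero, mul_one, sub_zero, zero_smul,
    Complex.mul_im, add_zero, zero_add, neg_smul] at h1
  rw [← h1, sub_eq_add_neg]

section Graph

variable {ι : Type} [Fintype ι] [DecidableEq ι]

/-- The matrix of the map `(z₁, z₂) ↦ z₂ - z₁`. -/
def diffMatrix (ι : Type) [DecidableEq ι] : Matrix ι (ι ⊕ ι) ℝ :=
  Matrix.fromCols (-1) 1

/-- The matrix of the map `z ↦ (z, S z)`. -/
def graphMatrix (S : Matrix ι ι ℝ) : Matrix (ι ⊕ ι) ι ℝ :=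
  Matrix.fromRows 1 S

theorem graph_eq_range (S : Matrix ι ι ℝ) :
    graph S = LinearMap.range (toEuclideanLin (graphMatrix S)) :=
  rfl

theorem prodJ_mul_prodJ {J : Matrix ι ι ℝ} (hJ : J * J = -1) : prodJ J * prodJ J = -1 := by
  rw [prodJ, fromBlocks_multiply, ← fromBlocks_one, fromBlocks_neg]
  simp [hJ]

theorem toEuclideanLin_diffMatrix_eq_zero_iff (y : EuclideanSpace ℝ (ι ⊕ ι)) :
    toEuclideanLin (diffMatrix ι) y = 0 ↔ y ∈ graph (1 : Matrix ι ι ℝ) := by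
  have h1 : toEuclideanLin (diffMatrix ι) y
      = WithLp.toLp 2 (fun i => y (Sum.inr i) - y (Sum.inl i)) := by
    ext i
    simp [diffMatrix, toLpLin_apply, mulVec, dotProduct, Matrix.one_apply, sub_eq_neg_add]
  have h2 : ∀ z : EuclideanSpace ℝ ι, toEuclideanLin (graphMatrix 1) z
      = WithLp.toLp 2 (Sum.elim z z) := by
    intro z
    ext i
    rcases i with i | i <;> simp [graphMatrix, toLpLin_apply]
  rw [h1, graph_eq_range, LinearMap.mem_range]
  constructor
  · intro h
    refine ⟨WithLp.toLp 2 (fun i => y (Sum.inl i)), ?_⟩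
    rw [h2]
    ext i
    rcases i with i | i
    · rfl
    · have := congrArg (fun w : EuclideanSpace ℝ ι => w i) h
      exact (sub_eq_zero.1 this).symm
  · rintro ⟨z, rfl⟩
    rw [h2]
    ext i
    simp

/-- The diagonal is isotropic, so ω(v, ·) factors through (z₁, z₂) ↦ z₂ - z₁. Explicitly, 𝒥(z, z) =
(-Jz, Jz) is the transpose of that map applied to Jz. -/
theorem symplForm_prodJ_of_mem_graph_one (J : Matrix ι ι ℝ) {v : EuclideanSpace ℝ (ι ⊕ ι)}
    (hv : v ∈ graph (1 : Matrix ι ι ℝ)) :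
    ∃ ρ : EuclideanSpace ℝ ι →ₗ[ℝ] ℝ, ∀ y,
      symplForm (prodJ J) v y = ρ (toEuclideanLin (diffMatrix ι) y) := by
  rw [graph_eq_range] at hv
  obtain ⟨z, rfl⟩ := hv
  refine ⟨(innerSL ℝ (toEuclideanLin J z) : EuclideanSpace ℝ ι →ₗ[ℝ] ℝ), fun y => ?_⟩
  have h1 : prodJ J * graphMatrix (1 : Matrix ι ι ℝ) = (diffMatrix ι)ᵀ * J := by
    simp [prodJ, diffMatrix, graphMatrix, fromBlocks_mul_fromRows, transpose_fromCols,
      fromRows_mul]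
  have h2 : toEuclideanLin (prodJ J) (toEuclideanLin (graphMatrix 1) z)
      = toEuclideanLin ((diffMatrix ι)ᵀ) (toEuclideanLin J z) := by
    ext1
    simp only [ofLp_toLpLin, toLin'_apply, mulVec_mulVec, h1]
  have h3 := LinearMap.adjoint_inner_left (toEuclideanLin (diffMatrix ι)) y (toEuclideanLin J z)
  rw [← toEuclideanLin_conjTranspose_eq_adjoint] at h3
  rw [symplForm, h2]
  simpa using h3

theorem differentiableOn_toEuclideanLin {m n : Type} [Fintype m] [DecidableEq m] [Fintype n]
    [DecidableEq n] {N : ℝ → Matrix m n ℝ} {s : Set ℝ}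
    (hN : ∀ i j, DifferentiableOn ℝ (fun t => N t i j) s) :
    DifferentiableOn ℝ (fun t => (toEuclideanLin (N t)).toContinuousLinearMap) s := by
  have h : (fun t => (toEuclideanLin (N t)).toContinuousLinearMap) = fun t => ∑ i, ∑ j,
      N t i j • (toEuclideanLin (Matrix.single i j (1 : ℝ))).toContinuousLinearMap := by
    ext1 t
    conv_lhs => rw [matrix_eq_sum_single (N t)]
    simp only [map_sum]
    refine Finset.sum_congr rfl fun i _ => Finset.sum_congr rfl fun j _ => ?_
    rw [← map_smul, ← map_smul, smul_single, smul_eq_mul, mul_one]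
  rw [h]
  exact DifferentiableOn.fun_sum fun i _ => DifferentiableOn.fun_sum fun j _ =>
    (hN i j).smul_const _

theorem det_toEuclideanLin (N : Matrix ι ι ℝ) : LinearMap.det (toEuclideanLin N) = N.det := by
  rw [toEuclideanLin_eq_toLin_orthonormal, LinearMap.det_toLin]

/-- Parity of the intersection number of `e^{-ε𝒥} Gr(S(t))` with `Σ(Δ)`. -/
theorem IsIntersectionNumber.even_of_det_pos {J : Matrix ι ι ℝ} (hJ : J * J = -1)
    {S : ℝ → Matrix ι ι ℝ} {a b ε : ℝ} {k : ℤ} (hab : a < b)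
    (hS : ∀ i j, DifferentiableOn ℝ (fun t => S t i j) (Set.Icc a b))
    (hk : IsIntersectionNumber (prodJ J) (graph 1)
      (fun t => (graph (S t)).map (toEuclideanLin (NormedSpace.exp (-(ε • prodJ J))))) a b k)
    (ha : 0 < (Real.cos ε • (S a - 1) - Real.sin ε • (J * (S a + 1))).det)
    (hb : 0 < (Real.cos ε • (S b - 1) - Real.sin ε • (J * (S b + 1))).det) : Even k := by
  rw [exp_neg_smul_of_sq_eq_neg_one (prodJ_mul_prodJ hJ)] at hk
  set E : Matrix (ι ⊕ ι) (ι ⊕ ι) ℝ := Real.cos ε • 1 - Real.sin ε • prodJ J with hE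
  obtain ⟨-, -, hk⟩ := hk
  -- Gap distance 1 is close enough: below it, projecting the frame of the rotated graph to `m t`
  -- loses no dimension.
  obtain ⟨m, hma, hmb, hclose, hm, rfl⟩ := hk 1 one_pos
  set N : ℝ → Matrix (ι ⊕ ι) ι ℝ := fun t => E * graphMatrix (S t) with hN
  set F : ℝ → EuclideanSpace ℝ ι →L[ℝ] EuclideanSpace ℝ (ι ⊕ ι) :=
    fun t => (toEuclideanLin (N t)).toContinuousLinearMap with hF
  have hrange : ∀ t, LinearMap.range (F t : EuclideanSpace ℝ ι →ₗ[ℝ] EuclideanSpace ℝ (ι ⊕ ι))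
      = (graph (S t)).map (toEuclideanLin E) := by
    intro t
    rw [graph_eq_range, ← LinearMap.range_comp]
    congr 1
    ext1 z
    ext1
    simp [hF, hN, toLpLin_apply, mulVec_mulVec]
  have hFd : DifferentiableOn ℝ F (Set.Icc a b) := by
    apply differentiableOn_toEuclideanLin
    intro i j
    simp only [hN, Matrix.mul_apply]
    refine DifferentiableOn.fun_sum fun l _ => DifferentiableOn.const_mul ?_ _
    rcases l with l | l
    · exact differentiableOn_const _
    · exact hS l j
  have hinj : ∀ t, Function.Injective (F t) := by
    intro t
    set G : Matrix ι (ι ⊕ ι) ℝ := fromCols 1 0 with hG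
    -- A left inverse of the frame: undo the rotation with e^{ε𝒥}, then take the first component.
    have h1 : (G * (Real.cos ε • 1 + Real.sin ε • prodJ J)) * N t = 1 := by
      have h2 : (Real.cos ε • 1 + Real.sin ε • prodJ J) * E = 1 := by
        have h3 := Real.cos_sq_add_sin_sq ε
        rw [hE, Matrix.add_mul, Matrix.mul_sub, Matrix.mul_sub]
        simp only [Matrix.smul_mul, Matrix.mul_smul, Matrix.one_mul, Matrix.mul_one,
          prodJ_mul_prodJ hJ, smul_smul]
        rw [mul_comm (Real.sin ε) (Real.cos ε), sub_add_sub_cancel, smul_neg, sub_neg_eq_add,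
          ← add_smul, ← sq, ← sq, h3, one_smul]
      simp only [hN]
      rw [Matrix.mul_assoc, ← Matrix.mul_assoc _ E, h2, Matrix.one_mul, hG, graphMatrix,
        fromCols_mul_fromRows]
      simp
    intro z w hzw
    have h2 := congrArg
      (fun y : EuclideanSpace ℝ (ι ⊕ ι) =>
        (G * (Real.cos ε • 1 + Real.sin ε • prodJ J)) *ᵥ y.ofLp) hzw
    simp only [hF, LinearMap.coe_toContinuousLinearMap', ofLp_toLpLin, toLin'_apply,
      mulVec_mulVec, h1, one_mulVec] at h2
    exact WithLp.ofLp_injective 2 h2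
  -- Where `m t` is the rotated graph, as at both end points, the projection fixes the frame and the
  -- determinant becomes explicit.
  have hdet : ∀ t, m t = (graph (S t)).map (toEuclideanLin E) →
      ((toEuclideanLin (diffMatrix ι)).toContinuousLinearMap ∘L (m t).starProjection ∘L F t).det
        = (Real.cos ε • (S t - 1) - Real.sin ε • (J * (S t + 1))).det := by
    intro t ht
    have h1 : diffMatrix ι * N t = Real.cos ε • (S t - 1) - Real.sin ε • (J * (S t + 1)) := by
      have h2 : E = fromBlocks (Real.cos ε • 1 + Real.sin ε • J) 0 0
          (Real.cos ε • 1 - Real.sin ε • J) := by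
        rw [hE, prodJ, ← fromBlocks_one, fromBlocks_smul, fromBlocks_smul, sub_eq_add_neg,
          fromBlocks_neg, fromBlocks_add]
        simp [sub_eq_add_neg]
      simp only [hN]
      rw [h2, diffMatrix, graphMatrix, fromBlocks_mul_fromRows, fromCols_mul_fromRows]
      simp only [Matrix.zero_mul, add_zero, zero_add, Matrix.mul_one, Matrix.neg_mul,
        Matrix.one_mul, Matrix.sub_mul, Matrix.smul_mul, Matrix.mul_add, smul_sub, smul_add]
      abel
    rw [← h1, ← det_toEuclideanLin, ContinuousLinearMap.det]
    congr 1
    ext1 z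
    have h2 : (m t).starProjection (F t z) = F t z := by
      rw [Submodule.starProjection_eq_self_iff, ht, ← hrange]
      exact ⟨z, rfl⟩
    simp only [ContinuousLinearMap.coe_coe, ContinuousLinearMap.comp_apply, h2]
    ext1
    simp [hF, toLpLin_apply, mulVec_mulVec]
  refine even_signedCrossings hab hm (toEuclideanLin (diffMatrix ι)).toContinuousLinearMap
    toEuclideanLin_diffMatrix_eq_zero_iff
    (fun v hv => symplForm_prodJ_of_mem_graph_one J hv) F hFd (fun t _ => hinj t) ?_ ?_ ?_
  · intro t ht
    have h := hclose t ht
    simp only [← hrange] at h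
    exact h
  · rw [hdet a hma]; exact ha
  · rw [hdet b hmb]; exact hb

end Graph

/-! ### The spectral conditions at the two end points. -/

/-- In complex eigencoordinates, (dᵢ - 1)²wᵢ = 0 forces (dᵢ - 1)wᵢ = 0. -/
theorem IsLinearlyStable.mulVec_sub_one_eq_zero {ι : Type} [Fintype ι] [DecidableEq ι]
    {S : Matrix ι ι ℝ} (hS : IsLinearlyStable S) (v : ι → ℝ)
    (hv : (S - 1) *ᵥ ((S - 1) *ᵥ v) = 0) : (S - 1) *ᵥ v = 0 := by
  obtain ⟨-, C, d, hC, hCd⟩ := hS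
  have hdet : IsUnit C.det := (Matrix.isUnit_iff_isUnit_det C).1 hC
  have hmap : ∀ w : ι → ℝ, Complex.ofRealHom ∘ ((S - 1) *ᵥ w)
      = (C * diagonal (fun i => d i - 1) * C⁻¹) *ᵥ (Complex.ofRealHom ∘ w) := by
    intro w
    have h1 : C * diagonal (fun i => d i - 1) * C⁻¹ = (S - 1).map Complex.ofRealHom := by
      have h2 : (S - 1).map Complex.ofRealHom = S.map Complex.ofReal - 1 := by
        ext i j
        by_cases hij : i = j <;> simp [hij]
      have h3 : diagonal (fun i => d i - 1) = diagonal d - 1 := by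
        rw [← diagonal_one, diagonal_sub]
      rw [h2, hCd, h3, Matrix.mul_sub, Matrix.sub_mul, Matrix.mul_one, mul_nonsing_inv _ hdet]
    rw [h1]
    ext i
    exact RingHom.map_mulVec Complex.ofRealHom (S - 1) w i
  set w : ι → ℂ := C⁻¹ *ᵥ (Complex.ofRealHom ∘ v) with hw
  have h1 : Complex.ofRealHom ∘ ((S - 1) *ᵥ v) = C *ᵥ (diagonal (fun i => d i - 1) *ᵥ w) := by
    rw [hmap, hw, mulVec_mulVec, mulVec_mulVec, Matrix.mul_assoc]
  have h2 : C *ᵥ (diagonal (fun i => d i - 1) *ᵥ (diagonal (fun i => d i - 1) *ᵥ w)) = 0 := by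
    have h3 := hmap ((S - 1) *ᵥ v)
    rw [hv, h1, ← mulVec_mulVec, ← mulVec_mulVec, mulVec_mulVec _ C⁻¹ C,
      nonsing_inv_mul _ hdet, one_mulVec] at h3
    rw [← h3]
    ext i
    simp
  have h3 : diagonal (fun i => d i - 1) *ᵥ (diagonal (fun i => d i - 1) *ᵥ w) = 0 := by
    have := congrArg (C⁻¹ *ᵥ ·) h2
    simpa [mulVec_mulVec, ← Matrix.mul_assoc, nonsing_inv_mul _ hdet] using this
  have h4 : diagonal (fun i => d i - 1) *ᵥ w = 0 := by
    ext i
    have := congrFun h3 i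
    simp only [mulVec_diagonal, Pi.zero_apply, mul_eq_zero] at this ⊢
    tauto
  rw [h4, mulVec_zero] at h1
  ext i
  have := congrFun h1 i
  simpa using this

/-- For s > 0 a zero would make s⁻¹ > 1 an eigenvalue off the unit circle; for s = 0 the matrix is
-1. -/
theorem IsLinearlyStable.det_smul_sub_one_ne_zero {ι : Type} [Fintype ι] [DecidableEq ι]
    {S : Matrix ι ι ℝ} (hS : IsLinearlyStable S) {s : ℝ} (hs : s ∈ Set.Ico (0 : ℝ) 1) :
    (s • S - 1).det ≠ 0 := by
  intro h0
  rcases eq_or_lt_of_le hs.1 with h | hpos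
  · subst h
    simp [det_neg] at h0
  have hmem : ((s : ℂ)⁻¹) ∈ spectrum ℂ (S.map Complex.ofReal) := by
    rw [spectrum.mem_iff, Matrix.isUnit_iff_isUnit_det, isUnit_iff_ne_zero, not_not]
    have h1 : algebraMap ℂ (Matrix ι ι ℂ) (s : ℂ)⁻¹ - S.map Complex.ofReal
        = (-(s : ℂ)⁻¹) • (s • S - 1).map Complex.ofRealHom := by
      have hs' : (s : ℂ) ≠ 0 := Complex.ofReal_ne_zero.2 hpos.ne'
      ext i j
      by_cases hij : i = j
      · simp [hij, Algebra.algebraMap_eq_smul_one]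
        field_simp
        ring
      · simp [hij, Algebra.algebraMap_eq_smul_one]
        field_simp
    have h2 : ((s • S - 1).map Complex.ofRealHom).det = 0 := by
      have := RingHom.map_det Complex.ofRealHom (s • S - 1)
      rw [h0, map_zero] at this
      exact this.symm
    rw [h1, det_smul, h2, mul_zero]
  have h3 := hS.1 hmem
  rw [mem_sphere_zero_iff_norm, norm_inv, Complex.norm_real, Real.norm_of_nonneg hpos.le,
    inv_eq_one] at h3
  exact hs.2.ne h3

/-- The vector w = (S - 1)v is fixed by S, hence by Sᵀ, hence orthogonal to the image of S - 1,
which contains w. -/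
theorem mulVec_sub_one_eq_zero_of_orthogonal {ι : Type} [Fintype ι] [DecidableEq ι]
    {S : Matrix ι ι ℝ} (hS : Sᵀ * S = 1) (v : ι → ℝ)
    (hv : (S - 1) *ᵥ ((S - 1) *ᵥ v) = 0) : (S - 1) *ᵥ v = 0 := by
  set w := (S - 1) *ᵥ v with hw
  have h1 : S *ᵥ w = w := by
    rwa [sub_mulVec, one_mulVec, sub_eq_zero] at hv
  have h2 : Sᵀ *ᵥ w = w := by
    conv_lhs => rw [← h1]
    rw [mulVec_mulVec, hS, one_mulVec]
  have h3 : w ⬝ᵥ w = 0 := by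
    conv_lhs => rw [hw]
    rw [← hw, dotProduct_mulVec, ← mulVec_transpose, transpose_sub, transpose_one, sub_mulVec, h2,
      one_mulVec, sub_self, zero_dotProduct]
  exact dotProduct_self_eq_zero.1 h3

/-- S preserves lengths, so sSv = v with v ≠ 0 would give s² = 1. -/
theorem det_smul_sub_one_ne_zero_of_orthogonal {ι : Type} [Fintype ι] [DecidableEq ι]
    {S : Matrix ι ι ℝ} (hS : Sᵀ * S = 1) {s : ℝ} (hs : s ∈ Set.Ico (0 : ℝ) 1) :
    (s • S - 1).det ≠ 0 := by
  intro h0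
  obtain ⟨v, hv0, hv⟩ := exists_mulVec_eq_zero_iff.2 h0
  rw [sub_mulVec, one_mulVec, sub_eq_zero, smul_mulVec] at hv
  have h1 : (S *ᵥ v) ⬝ᵥ (S *ᵥ v) = v ⬝ᵥ v := by
    rw [dotProduct_mulVec, ← mulVec_transpose, mulVec_mulVec, hS, one_mulVec]
  have h2 : s * (s * (v ⬝ᵥ v)) = v ⬝ᵥ v := by
    conv_rhs => rw [← hv]
    rw [smul_dotProduct, dotProduct_smul, h1, smul_eq_mul, smul_eq_mul]
  have h3 : v ⬝ᵥ v ≠ 0 := fun h => hv0 (dotProduct_self_eq_zero.1 h)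
  have h4 : s * s = 1 := mul_right_cancel₀ h3 (by rw [one_mul, mul_assoc, h2])
  nlinarith [hs.1, hs.2]

/-! ### Orthogonality of the holonomy and symplecticity of the flow. -/

/-- The transition matrix between two orthonormal bases of a symmetric bilinear form is
orthogonal. -/
theorem transition_mul_transpose {n : ℕ} {E : Type*} [AddCommGroup E] [Module ℝ E]
    (b : Module.Basis (Fin n) ℝ E) (β : LinearMap.BilinForm ℝ E) (hβ : ∀ u w, β u w = β w u)
    (u w : Fin n → E) (hu : ∀ i j, β (u i) (u j) = if i = j then 1 else 0)
    (hw : ∀ i j, β (w i) (w j) = if i = j then 1 else 0) :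
    (Matrix.of fun i j => β (u i) (w j)) * (Matrix.of fun i j => β (u i) (w j))ᵀ = 1 := by
  set G := LinearMap.BilinForm.toMatrix b β with hG
  have hmul : ∀ p q : Fin n → E, (Matrix.of fun i j => β (p i) (q j))
      = (b.toMatrix p)ᵀ * G * b.toMatrix q := by
    intro p q
    ext i j
    rw [Matrix.of_apply, LinearMap.BilinForm.apply_eq_dotProduct_toMatrix_mulVec b,
      Matrix.mul_assoc]
    rfl
  have hone : ∀ p : Fin n → E, (∀ i j, β (p i) (p j) = if i = j then 1 else 0) →
      (b.toMatrix p)ᵀ * G * b.toMatrix p = 1 := by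
    intro p hp
    rw [← hmul]
    ext i j
    rw [Matrix.of_apply, hp, Matrix.one_apply]
  have ht : (Matrix.of fun i j => β (u i) (w j))ᵀ = (b.toMatrix w)ᵀ * G * b.toMatrix u := by
    rw [← hmul]
    ext i j
    exact hβ _ _
  have h1 : b.toMatrix w * ((b.toMatrix w)ᵀ * G) = 1 := mul_eq_one_comm.1 (hone w hw)
  rw [ht, hmul u w]
  calc (b.toMatrix u)ᵀ * G * b.toMatrix w * ((b.toMatrix w)ᵀ * G * b.toMatrix u)
      = (b.toMatrix u)ᵀ * G * (b.toMatrix w * ((b.toMatrix w)ᵀ * G)) * b.toMatrix u := by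
        simp only [Matrix.mul_assoc]
    _ = 1 := by rw [h1, Matrix.mul_one, hone u hu]

/-- The flow of a linear Hamiltonian system is symplectic. -/
theorem transpose_mul_J_mul_of_hamiltonian {n : ℕ} {T : ℝ}
    {B ψ : ℝ → Matrix (Fin n ⊕ Fin n) (Fin n ⊕ Fin n) ℝ} (hB : ∀ t, (B t)ᵀ = B t) (h0 : ψ 0 = 1)
    (hψ : ∀ t ∈ Set.Icc 0 T, ∀ i j, HasDerivWithinAt (fun s => ψ s i j)
      ((J (Fin n) ℝ * B t * ψ t) i j) (Set.Icc 0 T) t) {t : ℝ} (ht : t ∈ Set.Icc 0 T) :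
    (ψ t)ᵀ * J (Fin n) ℝ * ψ t = J (Fin n) ℝ := by
  set Jn := J (Fin n) ℝ with hJn
  have hd : ∀ i j, ∀ t ∈ Set.Icc 0 T,
      HasDerivWithinAt (fun s => ((ψ s)ᵀ * Jn * ψ s) i j) 0 (Set.Icc 0 T) t := by
    intro i j t ht
    set ψ' := Jn * B t * ψ t with hψ'
    have h1 : HasDerivWithinAt (fun s => ∑ k, (∑ l, ψ s l i * Jn l k) * ψ s k j)
        (∑ k, ((∑ l, ψ' l i * Jn l k) * ψ t k j + (∑ l, ψ t l i * Jn l k) * ψ' k j))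
        (Set.Icc 0 T) t :=
      HasDerivWithinAt.fun_sum fun k _ =>
        (HasDerivWithinAt.fun_sum fun l _ => (hψ t ht l i).mul_const _).mul (hψ t ht k j)
    -- With JᵀJ = 1, J² = -1 and B symmetric, the two terms are ψᵀBψ and -ψᵀBψ.
    have h2 : ψ'ᵀ * Jn * ψ t + (ψ t)ᵀ * Jn * ψ' = 0 := by
      have h3 : Jn * Jn = -1 := J_squared _ _
      have h4 : Jnᵀ = -Jn := J_transpose _ _
      calc ψ'ᵀ * Jn * ψ t + (ψ t)ᵀ * Jn * ψ'
          = (ψ t)ᵀ * (B t)ᵀ * (Jnᵀ * Jn) * ψ t + (ψ t)ᵀ * (Jn * Jn) * B t * ψ t := by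
            rw [hψ', transpose_mul, transpose_mul]
            simp only [Matrix.mul_assoc]
        _ = 0 := by
            rw [h4, Matrix.neg_mul, h3, hB, neg_neg]
            simp
    have h3 : (∑ k, ((∑ l, ψ' l i * Jn l k) * ψ t k j + (∑ l, ψ t l i * Jn l k) * ψ' k j)) = 0 := by
      have := congrFun (congrFun h2 i) j
      simpa [Matrix.mul_apply, Finset.sum_add_distrib] using this
    rw [h3] at h1
    simpa only [Matrix.mul_apply, transpose_apply] using h1
  ext i j
  have hT : 0 ≤ T := ht.1.trans ht.2
  have h1 := constant_of_derivWithin_zero (f := fun s => ((ψ s)ᵀ * Jn * ψ s) i j)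
    (fun t ht => (hd i j t ht).differentiableWithinAt)
    (fun t ht => by
      have ht' : t ∈ Set.Icc 0 T := Set.Ico_subset_Icc_self ht
      exact (hd i j t ht').derivWithin (uniqueDiffOn_Icc (ht.1.trans_lt ht.2) t ht')) t ht
  simp only [h0] at h1
  simpa using h1

section Manifold

variable {n : ℕ} {M : Type*} [TopologicalSpace M] [ChartedSpace (EuclideanSpace ℝ (Fin n)) M]
  [IsManifold (𝓡 n) ∞ M]
  {g : Bundle.ContMDiffRiemannianMetric (𝓡 n) ∞ (EuclideanSpace ℝ (Fin n))
    (fun q : M => TangentSpace (𝓡 n) q)}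
  {T : ℝ} {L : ℝ → TangentBundle (𝓡 n) M → ℝ} {x : ℝ → M}
  {e : Fin n → (t : ℝ) → TangentSpace (𝓡 n) (x t)}

theorem secondVariationForm_comm (t : ℝ)
    (z z' : EuclideanSpace ℝ (Fin n) × EuclideanSpace ℝ (Fin n)) :
    secondVariationForm g L x e t z z' = secondVariationForm g L x e t z' z := by
  rw [secondVariationForm, secondVariationForm, add_comm z z']
  ring

theorem transpose_matrixB (t : ℝ) : (matrixB g L x e t)ᵀ = matrixB g L x e t := by
  have hP : (matrixP g L x e t)ᵀ = matrixP g L x e t := by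
    ext i j; exact secondVariationForm_comm _ _ _
  have hR : (matrixR g L x e t)ᵀ = matrixR g L x e t := by
    ext i j; exact secondVariationForm_comm _ _ _
  have hPi : ((matrixP g L x e t)⁻¹)ᵀ = (matrixP g L x e t)⁻¹ := by
    rw [transpose_nonsing_inv, hP]
  simp only [matrixB, fromBlocks_transpose, transpose_neg, transpose_sub, transpose_mul,
    transpose_transpose, hPi, hR, Matrix.mul_assoc]

theorem holonomyMatrix_mul_transpose (hx : x T = x 0) (he : IsParallelOrthonormalFrame g x e) :
    holonomyMatrix g T x e * (holonomyMatrix g T x e)ᵀ = 1 := by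
  -- The vectors `e j T` lie over x(T), while the holonomy pairs them with the metric at x(0);
  -- equality of the base points identifies the two metrics.
  have hpt : ∀ p q : M, p = q → ∀ u w : EuclideanSpace ℝ (Fin n),
      (g.inner p : EuclideanSpace ℝ (Fin n) → EuclideanSpace ℝ (Fin n) →L[ℝ] ℝ) u w
        = (g.inner q : EuclideanSpace ℝ (Fin n) → EuclideanSpace ℝ (Fin n) →L[ℝ] ℝ) u w := by
    rintro p _ rfl u w; rfl
  let β : LinearMap.BilinForm ℝ (TangentSpace (𝓡 n) (x 0)) :=
    LinearMap.mk₂ ℝ (fun u w => g.inner (x 0) u w) (fun _ _ _ => by simp) (fun _ _ _ => by simp)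
      (fun _ _ _ => by simp) (fun _ _ _ => by simp)
  let b : Module.Basis (Fin n) ℝ (TangentSpace (𝓡 n) (x 0)) :=
    (EuclideanSpace.basisFun (Fin n) ℝ).toBasis
  exact transition_mul_transpose b β (fun u w => g.symm (x 0) u w) (fun i => e i 0)
    (fun i => (show TangentSpace (𝓡 n) (x 0) from e i T)) (fun i j => he.orthonormal 0 i j)
    (fun i j => (hpt _ _ hx.symm _ _).trans (he.orthonormal T i j))

end Manifold

end Lagrangian

end

/-! ### Conclusion: stability forces an even index. -/

theorem mainTheorem5 {n : ℕ} {M : Type*} [TopologicalSpace M]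
    [ChartedSpace (EuclideanSpace ℝ (Fin n)) M] [IsManifold (𝓡 n) ∞ M]
    (g : Bundle.ContMDiffRiemannianMetric (𝓡 n) ∞ (EuclideanSpace ℝ (Fin n))
      (fun q : M => TangentSpace (𝓡 n) q))
    (T : ℝ) (hT : 0 < T)
    (L : ℝ → TangentBundle (𝓡 n) M → ℝ)
    (hL_smooth : ContMDiff (𝓘(ℝ, ℝ).prod (𝓡 n).tangent) 𝓘(ℝ, ℝ) ∞
      (fun p : ℝ × TangentBundle (𝓡 n) M => L p.1 p.2))
    (hL_periodic : ∀ t v, L (t + T) v = L t v)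
    (hN1 : Lagrangian.FibreNondegenerate L)
    (hN2 : Lagrangian.FibreQuadratic L)
    (x : ℝ → M) (hx : Lagrangian.IsPeriodicOrbit T L x)
    (e : Fin n → (t : ℝ) → TangentSpace (𝓡 n) (x t))
    (he : Lagrangian.IsParallelOrthonormalFrame g x e)
    (ψ : ℝ → Matrix (Fin n ⊕ Fin n) (Fin n ⊕ Fin n) ℝ)
    (hψ : Lagrangian.IsFundamentalSolution g T L x e ψ)
    (k : ℤ) (hk : Lagrangian.IsGeometricalIndex g T x e ψ k) (hk_odd : Odd k) :
    Lagrangian.IsLinearlyUnstable g T x e ψ := by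
  open Lagrangian Matrix in
  intro hstable
  have hxT : x T = x 0 := by simpa using hx.periodic 0
  set A := holonomyMatrix g T x e with hA
  set Ad := holonomyDouble g T x e with hAd
  have hAA : Aᵀ * A = 1 := mul_eq_one_comm.1 (holonomyMatrix_mul_transpose hxT he)
  have hAdAd : Adᵀ * Ad = 1 := by
    rw [hAd, holonomyDouble, ← hA, fromBlocks_transpose, fromBlocks_multiply, ← fromBlocks_one]
    simp [hAA]
  have hAdJ : Adᵀ * J (Fin n) ℝ * Ad = J (Fin n) ℝ := by
    rw [hAd, holonomyDouble, ← hA, fromBlocks_transpose, J, fromBlocks_multiply,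
      fromBlocks_multiply]
    simp [hAA]
  have hsymp : (Ad * ψ T)ᵀ * J (Fin n) ℝ * (Ad * ψ T) = J (Fin n) ℝ := by
    have h1 := transpose_mul_J_mul_of_hamiltonian (fun t => transpose_matrixB t) hψ.initial
      hψ.equation (Set.right_mem_Icc.2 hT.le)
    calc (Ad * ψ T)ᵀ * J (Fin n) ℝ * (Ad * ψ T)
        = (ψ T)ᵀ * (Adᵀ * J (Fin n) ℝ * Ad) * ψ T := by
          rw [transpose_mul]; simp only [Matrix.mul_assoc]
      _ = J (Fin n) ℝ := by rw [hAdJ, h1]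
  have hpos₀ := eventually_det_pos Ad hAdJ (mulVec_sub_one_eq_zero_of_orthogonal hAdAd)
    (fun s hs => det_smul_sub_one_ne_zero_of_orthogonal hAdAd hs)
  have hpos₁ := eventually_det_pos (Ad * ψ T) hsymp hstable.mulVec_sub_one_eq_zero
    (fun s hs => hstable.det_smul_sub_one_ne_zero hs)
  have hk' : IsCLMIndex (prodJ (J (Fin n) ℝ)) (graph 1) (fun t => graph (Ad * ψ t)) 0 T k := hk
  -- One ε > 0 small enough for the definition of the index and for positivity at both ends.
  obtain ⟨ε, hε, hε₀, hε₁⟩ := (hk'.and (hpos₀.and hpos₁)).exists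
  have hdiff : ∀ i j, DifferentiableOn ℝ (fun t => (Ad * ψ t) i j) (Set.Icc 0 T) := by
    intro i j
    simp only [Matrix.mul_apply]
    exact DifferentiableOn.fun_sum fun l _ => DifferentiableOn.const_mul
      (fun t ht => (hψ.equation t ht l j).differentiableWithinAt) _
  have heven : Even k := by
    refine IsIntersectionNumber.even_of_det_pos (J_squared _ _) hT hdiff hε ?_ hε₁
    rw [hψ.initial, Matrix.mul_one]
    exact hε₀
  exact (Int.not_even_iff_odd.2 hk_odd) heven
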